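/- \textbf{Setting.} Let $d:X\times X\to[0,\infty)$ be a symmetric function on a set $X$ with $d(u,u)=0$ and $d(u,v)\le D\,(d(u,w)+d(w,v))$ for all $u,v,w\in X$, where $D\ge 1$ is a constant (a ``$D$-cost''; for the $k$-means cost $d(u,v)=\|u-v\|^2$ and $D=2$). For data points $x_1,\dots,x_n\in X$ and a set $S$ of centers put $cost(S)=\sum_{t=1}^n\min_{c\in S}d(x_t,c)$ (with $cost(\emptyset)=\infty$ if $n\ge1$), and let $cost(opt_k)$ be the minimum of $cost(\{c_1,\dots,c_k\})$ over $c_1,\dots,c_k\in\{x_1,\dots,x_n\}$. In the online no-substitution setting the points arrive one after another, and on arrival of a point the algorithm decides irrevocably, from $n$, the earlier points and this point only, whether to take it as a center; $cost(alg)$ is the cost of the set of taken points on the whole dataset. \textbf{Algorithm.} Let $k\ge2$ and $a\ge1$, and let $\mathcal O$ be an offline algorithm that for every nonempty finite list $M$ of points returns $k$ centers out of $M$ (repetitions allowed) whose cost on $M$ is at most $a$ times the optimal cost on $M$ with $k$ centers out of $M$. If $n<10^2k$, take every point. Otherwise: \begin{itemize} \item Phase 1: let $M_1$ be the first $\lfloor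 n/(10^2k)\rfloor$ points; take none of them as a center, and let $(c_1,\dots,c_k)=\mathcal O(M_1)$. \item Phase 2: let $M_2$ be the next $\lfloor n/(10^5k^3)\rfloor$ points; take none of them. For each $i$ let $A[i]$ be the list of the $y\in M_2$ whose nearest center is $c_i$ (ties go to the smallest index), let $R_{max}[i]=\max_{y\in A[i]}d(y,c_i)$, with $R_{max}[i]=-\infty$ if $A[i]$ is empty, and set a counter $N[i]=0$. \item Phase 3: for each remaining point $y$, in order of arrival, let $c_i$ be its nearest center. If $d(y,c_i)>R_{max}[i]$, take $y$ (far point). If $N[i]\le 3k\log(40k)$ (natural logarithm), take $y$ (close point) and increase $N[i]$ by one. \end{itemize} \textbf{Theorem.} There is an absolute constant $C$, and for all $k\ge2$, $D\ge1$, $a\ge1$ there is a constant $K=K(k,D,a)$, such that for every $D$-cost, every such $\mathcal O$, every $n$ and all data points $x_1,\dots,x_n$ (not necessarily distinct) that arrive in uniformly random order, the following holds. With probability at least $0.9$ over the order, the algorithm takes at most $C k^5$ centers and, at the same time, $cost(alg)\le K\cdot cost(opt_k)$. -/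

import Mathlib

open scoped NNReal ENNReal

universe u

namespace NoSubstitution

variable {X : Type u}

/-- `d` is the distance function of a `D`-cost: nonnegative (by its type), zero on the diagonal,
symmetric, and subject to the triangle inequality up to the factor `D`. -/
structure IsDCost (D : ℝ≥0) (d : X → X → ℝ≥0) : Prop where
  self : ∀ u, d u u = 0
  symm : ∀ u v, d u v = d v u
  triangle : ∀ u v w, d u v ≤ D * (d u w + d w v)

/-- The cost of the set of centers `S` on the points `x i`: every point pays the distance to its
closest center. Without any center, a point pays `∞`. -/
noncomputable def cost {ι : Type*} [Fintype ι] (d : X → X → ℝ≥0) (x : ι → X) (S : Set X) : ℝ≥0∞ :=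
  ∑ i, ⨅ c ∈ S, (d (x i) c : ℝ≥0∞)

/-- The optimal cost with `k` centers, which are chosen among the points themselves. -/
noncomputable def optCost {ι : Type*} [Fintype ι] (d : X → X → ℝ≥0) (k : ℕ) (x : ι → X) : ℝ≥0∞ :=
  ⨅ c : Fin k → ι, cost d x (Set.range (x ∘ c))

/-- `off` is an offline `a`-approximation algorithm: on every nonempty list `M` of points it returns
`k` centers (repetitions allowed) out of `M`, of cost at most `a` times the optimal one for `M`. -/
def IsOfflineApprox (d : X → X → ℝ≥0) (k : ℕ) (a : ℝ≥0) (off : List X → Fin k → X) : Prop :=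
  ∀ M : List X, M ≠ [] →
    (∀ i, off M i ∈ M) ∧ cost d M.get (Set.range (off M)) ≤ a * optCost d k M.get

/-- An online no-substitution algorithm that knows the number `n` of points in advance. For `n`, the
list of the points that arrived before (in order of arrival) and the point that arrives now, it says
whether the latter is taken as a center. Decisions are never revised. -/
abbrev OnlineAlg (X : Type u) := ℕ → List X → X → Prop

open Classical in
/-- The times at which the algorithm takes the arriving point when the stream is `s 0, s 1, …`. -/
noncomputable def OnlineAlg.taken (alg : OnlineAlg X) {n : ℕ} (s : Fin n → X) : Finset (Fin n) :=
  Finset.univ.filter fun t => alg n ((List.ofFn s).take t) (s t)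

/-- `i` is the `argmin` of the distance from `y` to the centers; ties go to the smallest index. -/
def IsNearest {k : ℕ} (d : X → X → ℝ≥0) (c : Fin k → X) (y : X) (i : Fin k) : Prop :=
  (∀ j, d y (c i) ≤ d y (c j)) ∧ ∀ j < i, d y (c i) < d y (c j)

open Classical in
/-- The set `A[i]`: the points of the second sample whose nearest center is `c i`. -/
noncomputable def cell {k : ℕ} (d : X → X → ℝ≥0) (c : Fin k → X) (M₂ : List X) (i : Fin k) :
    List X :=
  M₂.filter fun y => IsNearest d c y i

/-- The threshold `R_max[i]`: the maximal distance between `c i` and a point of `A[i]`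
(`0` if `A[i]` is empty). -/
noncomputable def rmax {k : ℕ} (d : X → X → ℝ≥0) (c : Fin k → X) (M₂ : List X) (i : Fin k) : ℝ≥0 :=
  ((cell d c M₂ i).map fun y => d y (c i)).foldr max 0

/-- `y`, with nearest center `c i`, is far: its distance to `c i` exceeds the threshold. If `A[i]` is
empty then every point counts as far. By `isFar_iff`, this is the test `R_max[i] < d y (c i)` with
`R_max[i] = 0` for empty `A[i]`, unless `y` is at distance zero from `c i`. -/
def IsFar {k : ℕ} (d : X → X → ℝ≥0) (c : Fin k → X) (M₂ : List X) (i : Fin k) (y : X) : Prop :=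
  cell d c M₂ i = [] ∨ rmax d c M₂ i < d y (c i)

theorem isFar_iff {k : ℕ} (d : X → X → ℝ≥0) (c : Fin k → X) (M₂ : List X) (i : Fin k) (y : X)
    (h : 0 < d y (c i)) : IsFar d c M₂ i y ↔ rmax d c M₂ i < d y (c i) := by
  refine ⟨?_, Or.inr⟩
  rintro (h0 | h0)
  · simpa [rmax, h0] using h
  · exact h0

open Classical in
/-- The counter of the close points of center `c i`, after the points `past` of the third phase:
a point with nearest center `c i` is taken as a close point, and counted, as long as the counter is
at most `3 k log (40 k)`. -/
noncomputable def closeCounter {k : ℕ} (d : X → X → ℝ≥0) (c : Fin k → X) (i : Fin k)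
    (past : List X) : ℕ :=
  past.foldl
    (fun m y => if IsNearest d c y i ∧ (m : ℝ) ≤ 3 * k * Real.log (40 * k) then m + 1 else m) 0

/-- The three-phase algorithm, with the offline algorithm `off` as a subroutine.
Phase 1: the first `⌊n / (10² k)⌋` points are only stored, and `off` computes centers for them.
Phase 2: the next `⌊n / (10⁵ k³)⌋` points are only stored; they set the thresholds.
Phase 3: an arriving point with nearest center `c i` is taken if it is far or if not enough
close points of `c i` have been taken yet.
If there is no point in phase 1, that is `n < 10² k`, then all points are taken. -/
noncomputable def threePhase (d : X → X → ℝ≥0) (k : ℕ) (off : List X → Fin k → X) : OnlineAlg X :=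
  fun n past y =>
    let m₁ := n / (10 ^ 2 * k)
    let m₂ := n / (10 ^ 5 * k ^ 3)
    let c := off (past.take m₁)
    let M₂ := (past.drop m₁).take m₂
    m₁ = 0 ∨
      (m₁ + m₂ ≤ past.length ∧
        ∃ i, IsNearest d c y i ∧
          (IsFar d c M₂ i y ∨
            (closeCounter d c i (past.drop (m₁ + m₂)) : ℝ) ≤ 3 * k * Real.log (40 * k)))

end NoSubstitution

namespace NoSubstitution

open Finset Equiv

/-! The arrival order is a uniform permutation, and every probability is a proportion of
permutations. Let `O` be the optimal cost, call an optimal cluster large if it has at least `s =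
1000 k²` points, and let `L` be the union of the large clusters.

Cost: for an order that satisfies `IsRepresentative`, the bound is deterministic
(`exists_taken_sum_le`). The first sample contains a fair share of each large cluster, so the sample
centers, being near-optimal for the sample, cost `O(O)` on all of `L` (`sum_nearest_le_of_sample`;
constants depend on `k`, `D`, `a`). The points outside `L` are at most `k - 1` times as many as
those of a given large cluster, so by pigeonhole some phase 3 cell contains much of that cluster and
consists to a fraction of at least `1 / (3k)` of points of `L` near the cell center. One of the
first `3k log (40k)` or so points of the cell is of this kind and is taken
(`exists_taken_near_center`). A small cluster has fewer than `s` points, so it suffices to serve its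
center: either this center is taken, or it is not far. In the latter case a point of the second
sample in its cell is at least as distant from the cell center; that point lies in a large cluster,
and a taken point near the center of this large cluster serves the small cluster as well.

Number of centers: close points are capped by the counters. Given the first phase, a phase 3 point
and the second sample are exchangeable, and each of the `k` cells has at most one strict record, so
the point is far with probability at most `k / (m₂ + 1)` (`card_record_mul_le`). Summation and
Markov's inequality give fewer than `10⁷ k⁴` far points.

Probability: Markov's inequality handles most of the bad events. The fair share of large clusters
comes from a block argument (`card_small_sample_le`), and the taken good points come from
conditioning on the first two phases and on the positions of a cell (`card_first_avoid_le`). -/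

/-! ### Counting permutations: hitting probabilities, Markov's inequality, conditioning, records. -/

/-- In a family of permutations that all map `P` onto `Q` and that is closed under transpositions of
points of `P`, the points of `A ⊆ P` hit `B ⊆ Q` simultaneously with probability at most
`(|B| / |Q|) ^ |A|`. -/
theorem card_forall_mem_mul_pow_le {α : Type*} [DecidableEq α] (F : Finset (Perm α))
    (P Q B A : Finset α) (hB : B ⊆ Q) (hPQ : ∀ σ ∈ F, P.image σ = Q)
    (hF : ∀ σ ∈ F, ∀ p ∈ P, ∀ q ∈ P, σ * swap p q ∈ F) (hA : A ⊆ P) :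
    (F.filter fun σ => ∀ p ∈ A, σ p ∈ B).card * Q.card ^ A.card ≤ B.card ^ A.card * F.card := by
  induction A using Finset.induction_on with
  | empty => simp
  | insert a A ha ih =>
    have haP : a ∈ P := hA (mem_insert_self _ _)
    have hAP : A ⊆ P := (subset_insert _ _).trans hA
    have ih := ih hAP
    rcases F.eq_empty_or_nonempty with rfl | ⟨σ₀, hσ₀⟩
    · simp
    have hcard : P.card = Q.card := by
      rw [← hPQ σ₀ hσ₀, card_image_of_injective _ σ₀.injective]
    have hbq : B.card ≤ Q.card := card_le_card hB
    have hlt : A.card < Q.card := by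
      rw [← hcard]; exact card_lt_card ⟨hAP, fun h => ha (h haP)⟩
    set N := (F.filter fun σ => ∀ p ∈ A, σ p ∈ B).card with hN
    set N' := (F.filter fun σ => ∀ p ∈ insert a A, σ p ∈ B).card with hN'
    -- Double counting of pairs of a permutation sending `A` into `B` and a further position `x ∈ P
    -- \ A` sent into `B`. The swap of `a` and `x` makes all `x` equivalent, and at most `|B| - |A|`
    -- values of `B` remain for them.
    have hstep : (Q.card - A.card) * N' ≤ (B.card - A.card) * N := by
      have h1 : ∀ x ∈ P \ A,
          (F.filter fun σ => (∀ p ∈ A, σ p ∈ B) ∧ σ x ∈ B).card = N' := by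
        intro x hx
        obtain ⟨hxP, hxA⟩ := mem_sdiff.1 hx
        refine card_nbij' (fun σ => σ * swap a x) (fun σ => σ * swap a x) ?_ ?_ ?_ ?_
        · intro σ hσ
          simp only [coe_filter, Set.mem_ofPred_eq, forall_mem_insert] at hσ ⊢
          refine ⟨hF σ hσ.1 a haP x hxP, by simpa using hσ.2.2, fun p hp => ?_⟩
          rw [Perm.mul_apply, swap_apply_of_ne_of_ne]
          · exact hσ.2.1 p hp
          · rintro rfl; exact ha hp
          · rintro rfl; exact hxA hp
        · intro σ hσ
          simp only [coe_filter, Set.mem_ofPred_eq, forall_mem_insert] at hσ ⊢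
          refine ⟨hF σ hσ.1 a haP x hxP, fun p hp => ?_, by simpa using hσ.2.1⟩
          rw [Perm.mul_apply, swap_apply_of_ne_of_ne]
          · exact hσ.2.2 p hp
          · rintro rfl; exact ha hp
          · rintro rfl; exact hxA hp
        · intro σ _; simp [mul_assoc]
        · intro σ _; simp [mul_assoc]
      have h2 : ∑ x ∈ P \ A, (F.filter fun σ => (∀ p ∈ A, σ p ∈ B) ∧ σ x ∈ B).card
          = ∑ σ ∈ F.filter (fun σ => ∀ p ∈ A, σ p ∈ B),
              ((P \ A).filter fun x => σ x ∈ B).card := by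
        simp only [← filter_filter]
        exact sum_card_bipartiteAbove_eq_sum_card_bipartiteBelow (fun x (σ : Perm α) => σ x ∈ B)
      have h3 : ∀ σ ∈ F.filter (fun σ => ∀ p ∈ A, σ p ∈ B),
          ((P \ A).filter fun x => σ x ∈ B).card ≤ B.card - A.card := by
        intro σ hσ
        rw [mem_filter] at hσ
        have : ((P \ A).filter fun x => σ x ∈ B).image σ ⊆ B \ A.image σ := by
          intro y hy
          obtain ⟨x, hx, rfl⟩ := mem_image.1 hy
          rw [mem_filter, mem_sdiff] at hx
          simp [hx.2, hx.1.2]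
        have h := card_le_card this
        rw [card_image_of_injective _ σ.injective, card_sdiff_of_subset,
          card_image_of_injective _ σ.injective] at h
        · exact h
        · intro y hy
          obtain ⟨x, hx, rfl⟩ := mem_image.1 hy
          exact hσ.2 x hx
      calc (Q.card - A.card) * N'
          = ∑ x ∈ P \ A, (F.filter fun σ => (∀ p ∈ A, σ p ∈ B) ∧ σ x ∈ B).card := by
            rw [sum_congr rfl h1, sum_const, smul_eq_mul, card_sdiff_of_subset hAP, hcard]
        _ ≤ ∑ _σ ∈ F.filter (fun σ => ∀ p ∈ A, σ p ∈ B), (B.card - A.card) := by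
            rw [h2]; exact sum_le_sum h3
        _ = _ := by rw [sum_const, smul_eq_mul, mul_comm]
    rw [card_insert_of_notMem ha]
    have h4 : Q.card * (B.card - A.card) ≤ B.card * (Q.card - A.card) := by
      rw [Nat.mul_sub, Nat.mul_sub, mul_comm Q.card B.card]
      exact Nat.sub_le_sub_left (Nat.mul_le_mul_right _ hbq) _
    refine Nat.le_of_mul_le_mul_left ?_ (Nat.sub_pos_of_lt hlt)
    calc (Q.card - A.card) * (N' * Q.card ^ (A.card + 1))
        = Q.card * Q.card ^ A.card * ((Q.card - A.card) * N') := by ring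
      _ ≤ Q.card * Q.card ^ A.card * ((B.card - A.card) * N) := Nat.mul_le_mul_left _ hstep
      _ = (Q.card * (B.card - A.card)) * (N * Q.card ^ A.card) := by ring
      _ ≤ (B.card * (Q.card - A.card)) * (B.card ^ A.card * F.card) := Nat.mul_le_mul h4 ih
      _ = _ := by ring

/-- A uniformly random permutation maps `A` into `B` with probability at most
`(|B| / |α|) ^ |A|`. -/
theorem card_perm_forall_mem_mul_pow_le {α : Type*} [Fintype α] [DecidableEq α]
    (A B : Finset α) :
    (univ.filter fun σ : Perm α => ∀ p ∈ A, σ p ∈ B).card * Fintype.card α ^ A.card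
      ≤ B.card ^ A.card * Fintype.card (Perm α) := by
  have h := card_forall_mem_mul_pow_le (univ : Finset (Perm α)) univ univ B A (subset_univ _)
    (fun σ _ => image_univ_equiv σ) (fun _ _ _ _ _ _ => mem_univ _) (subset_univ _)
  rw [← card_univ, ← card_univ]
  convert h

/-- The expected number of points of `A` that a random permutation maps into `B`. -/
theorem sum_card_filter_mem_mul_le {α : Type*} [Fintype α] [DecidableEq α] (A B : Finset α) :
    (∑ σ : Perm α, (A.filter fun p => σ p ∈ B).card) * Fintype.card α
      ≤ A.card * B.card * Fintype.card (Perm α) := by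
  have h : ∑ σ : Perm α, (A.filter fun p => σ p ∈ B).card
      = ∑ p ∈ A, (univ.filter fun σ : Perm α => σ p ∈ B).card :=
    (sum_card_bipartiteAbove_eq_sum_card_bipartiteBelow (fun p (σ : Perm α) => σ p ∈ B)).symm
  rw [h, sum_mul]
  calc _ ≤ ∑ p ∈ A, B.card * Fintype.card (Perm α) := by
        refine sum_le_sum fun p _ => ?_
        simpa using card_perm_forall_mem_mul_pow_le {p} B
    _ = _ := by rw [sum_const, smul_eq_mul, mul_assoc]

/-- Markov's inequality for counting. -/
theorem card_filter_le_mul_le_sum {ι : Type*} (F : Finset ι) (f : ι → ℕ) (r : ℕ) :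
    (F.filter fun σ => r ≤ f σ).card * r ≤ ∑ σ ∈ F, f σ := by
  calc _ = ∑ σ ∈ F.filter (fun σ => r ≤ f σ), r := by rw [sum_const, smul_eq_mul]
    _ ≤ ∑ σ ∈ F.filter (fun σ => r ≤ f σ), f σ :=
        sum_le_sum fun σ hσ => (mem_filter.1 hσ).2
    _ ≤ _ := sum_le_sum_of_subset (filter_subset _ _)

/-- Once the positions of a cell are fixed, its first `N` arrivals occupy a fixed set of positions,
to which the product bound for avoiding a set applies. -/
theorem exists_initial_subset {α : Type*} [LinearOrder α] (P : Finset α) {N : ℕ}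
    (hN : N ≤ P.card) :
    ∃ A ⊆ P, A.card = N ∧ ∀ p ∈ A, (P.filter fun q => q < p).card < N := by
  have hinj : Function.Injective fun i : Fin N => P.orderEmbOfFin rfl (i.castLE hN) :=
    fun i j h => by simpa [Fin.ext_iff] using h
  refine ⟨univ.image fun i : Fin N => P.orderEmbOfFin rfl (i.castLE hN), ?_, ?_, ?_⟩
  · intro p hp
    obtain ⟨i, -, rfl⟩ := mem_image.1 hp
    exact orderEmbOfFin_mem _ _ _
  · rw [card_image_of_injective _ hinj, card_univ, Fintype.card_fin]
  · intro p hp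
    obtain ⟨i, -, rfl⟩ := mem_image.1 hp
    have hsub : (P.filter fun q => q < P.orderEmbOfFin rfl (i.castLE hN))
        ⊆ (Iio i).image fun i : Fin N => P.orderEmbOfFin rfl (i.castLE hN) := by
      intro q hq
      obtain ⟨hqP, hqi⟩ := mem_filter.1 hq
      have : q ∈ Set.range (P.orderEmbOfFin rfl) := by rw [range_orderEmbOfFin]; exact hqP
      obtain ⟨j, rfl⟩ := this
      have hj : j < i.castLE hN := (P.orderEmbOfFin rfl).lt_iff_lt.1 hqi
      refine mem_image.2 ⟨⟨j, lt_trans hj i.2⟩, mem_Iio.2 hj, rfl⟩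
    calc _ ≤ _ := card_le_card hsub
      _ ≤ (Iio i).card := card_image_le
      _ < N := by rw [Fin.card_Iio]; exact i.2

/-- A bound on the proportion of `S` in every fiber of `f` is a bound on the proportion of `S`. -/
theorem card_le_mul_card_of_fiberwise {α β : Type*} [Fintype α] [DecidableEq β] (f : α → β)
    (S : Finset α) {ε : ℝ} (hε : 0 ≤ ε)
    (h : ∀ a ∈ S, ((S.filter fun b => f b = f a).card : ℝ)
      ≤ ε * (univ.filter fun b => f b = f a).card) :
    (S.card : ℝ) ≤ ε * Fintype.card α := by
  classical
  rw [card_eq_sum_card_fiberwise (f := f) (t := univ.image f) (fun a _ => by simp), ← card_univ,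
    card_eq_sum_card_fiberwise (s := univ) (f := f) (t := univ.image f) (fun a _ => by simp)]
  push_cast
  rw [mul_sum]
  refine sum_le_sum fun y _ => ?_
  rcases (S.filter fun b => f b = y).eq_empty_or_nonempty with h0 | ⟨a, ha⟩
  · rw [h0]; simp only [card_empty, Nat.cast_zero]; positivity
  · obtain ⟨haS, rfl⟩ := mem_filter.1 ha
    exact h a haS

/-- Let `Q σ` and `G σ ⊆ Q σ` be sets that depend only on the values of `σ` at the positions before
`m` and that contain none of these values. If `G σ` makes up a fraction of at least `1 / r` of `Q σ`,
then the first `N` elements of `Q σ` in the order of arrival avoid `G σ` with probability at most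
`(1 - 1 / r) ^ N`. -/
theorem card_first_avoid_le {n m N r : ℕ} (hr : 1 ≤ r) (Q G : Perm (Fin n) → Finset (Fin n))
    (hQ : ∀ σ τ : Perm (Fin n), (∀ p : Fin n, p.1 < m → σ p = τ p) → Q σ = Q τ)
    (hG : ∀ σ τ : Perm (Fin n), (∀ p : Fin n, p.1 < m → σ p = τ p) → G σ = G τ)
    (hGQ : ∀ σ, G σ ⊆ Q σ) (hm : ∀ (σ : Perm (Fin n)) (p : Fin n), σ p ∈ Q σ → m ≤ p.1) :
    ((univ.filter fun σ : Perm (Fin n) => (Q σ).Nonempty ∧ (Q σ).card ≤ r * (G σ).card ∧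
      ∀ p, σ p ∈ Q σ → (univ.filter fun q => q < p ∧ σ q ∈ Q σ).card < N → σ p ∉ G σ).card : ℝ)
      ≤ (1 - 1 / r) ^ N * Fintype.card (Perm (Fin n)) := by
  have hr1 : (1 / r : ℝ) ≤ 1 := by
    rw [div_le_one (by positivity)]; exact_mod_cast hr
  -- Conditioning on the prefix and on the set of positions occupied by `Q σ`. Within a fiber `Q`
  -- and `G` are constant and only the arrangement outside the prefix varies; the fiber is closed
  -- under swaps inside these positions.
  refine card_le_mul_card_of_fiberwise
    (fun σ : Perm (Fin n) =>
      ((fun p : {p : Fin n // p.1 < m} => σ p), univ.filter fun p => σ p ∈ Q σ)) _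
    (pow_nonneg (by linarith) _) fun σ₀ hσ₀ => ?_
  obtain ⟨-, hne, hle, hfirst⟩ := mem_filter.1 hσ₀
  set P := univ.filter fun p => σ₀ p ∈ Q σ₀ with hP
  set F : Finset (Perm (Fin n)) := univ.filter fun σ =>
    ((fun p : {p : Fin n // p.1 < m} => σ p), univ.filter fun p => σ p ∈ Q σ)
      = ((fun p : {p : Fin n // p.1 < m} => σ₀ p), P) with hFdef
  have hmemF : ∀ σ, σ ∈ F ↔ (∀ p : Fin n, p.1 < m → σ p = σ₀ p) ∧ ∀ p, σ p ∈ Q σ ↔ p ∈ P := by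
    intro σ
    simp only [hFdef, mem_filter, mem_univ, true_and, Prod.mk.injEq, funext_iff, Subtype.forall,
      Finset.ext_iff]
  have hPQ : ∀ σ ∈ F, P.image σ = Q σ₀ := by
    intro σ hσ
    obtain ⟨h1, h2⟩ := (hmemF σ).1 hσ
    ext y
    rw [← hQ σ σ₀ h1, mem_image]
    constructor
    · rintro ⟨p, hp, rfl⟩; exact (h2 p).2 hp
    · intro hy; exact ⟨σ.symm y, (h2 _).1 (by simpa using hy), by simp⟩
  have hPm : ∀ p ∈ P, m ≤ p.1 := fun p hp => hm σ₀ p (mem_filter.1 hp).2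
  have hF : ∀ σ ∈ F, ∀ p ∈ P, ∀ q ∈ P, σ * swap p q ∈ F := by
    intro σ hσ p hp q hq
    obtain ⟨h1, h2⟩ := (hmemF σ).1 hσ
    have hpre : ∀ u : Fin n, u.1 < m → (σ * swap p q) u = σ u := by
      intro u hu
      rw [Perm.mul_apply, swap_apply_of_ne_of_ne]
      · rintro rfl; exact absurd (hPm _ hp) (by omega)
      · rintro rfl; exact absurd (hPm _ hq) (by omega)
    refine (hmemF _).2 ⟨fun u hu => (hpre u hu).trans (h1 u hu), fun u => ?_⟩
    rw [hQ _ _ hpre, Perm.mul_apply, h2]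
    rcases eq_or_ne u p with rfl | hup
    · simp [hp, hq]
    rcases eq_or_ne u q with rfl | huq
    · simp [hp, hq]
    rw [swap_apply_of_ne_of_ne hup huq]
  have hcP : P.card = (Q σ₀).card := by
    rw [← hPQ σ₀ ((hmemF σ₀).2 ⟨fun _ _ => rfl, fun p => by simp [hP]⟩),
      card_image_of_injective _ σ₀.injective]
  have hQpos : 0 < (Q σ₀).card := hne.card_pos
  -- With fewer than `N` positions, all of `Q` would count as early, including a point of the
  -- nonempty `G`.
  have hNP : N ≤ P.card := by
    by_contra! hlt
    have hGpos : 0 < (G σ₀).card := by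
      rcases Nat.eq_zero_or_pos (G σ₀).card with h | h
      · rw [h] at hle; omega
      · exact h
    obtain ⟨y, hy⟩ := card_pos.1 hGpos
    refine hfirst (σ₀.symm y) (by simpa using hGQ _ hy) (lt_of_le_of_lt (card_le_card ?_) hlt)
      (by simpa using hy)
    intro q hq
    simp only [mem_filter, mem_univ, true_and, hP] at hq ⊢
    exact hq.2
  obtain ⟨A, hAP, hAN, hA⟩ := exists_initial_subset P hNP
  have hbound := card_forall_mem_mul_pow_le F P (Q σ₀) (Q σ₀ \ G σ₀) A sdiff_subset hPQ hF hAP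
  have hsub : ((univ.filter fun σ : Perm (Fin n) => (Q σ).Nonempty ∧ (Q σ).card ≤ r * (G σ).card ∧
      ∀ p, σ p ∈ Q σ → (univ.filter fun q => q < p ∧ σ q ∈ Q σ).card < N → σ p ∉ G σ).filter
        fun σ => ((fun p : {p : Fin n // p.1 < m} => σ p), univ.filter fun p => σ p ∈ Q σ)
      = ((fun p : {p : Fin n // p.1 < m} => σ₀ p), P))
      ⊆ F.filter fun σ => ∀ p ∈ A, σ p ∈ Q σ₀ \ G σ₀ := by
    intro σ hσ
    obtain ⟨h1, h2⟩ := mem_filter.1 hσ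
    have hσF : σ ∈ F := mem_filter.2 ⟨mem_univ _, h2⟩
    obtain ⟨h3, h4⟩ := (hmemF σ).1 hσF
    refine mem_filter.2 ⟨hσF, fun p hp => ?_⟩
    have hpQ : σ p ∈ Q σ := (h4 p).2 (hAP hp)
    rw [mem_sdiff, ← hQ _ _ h3, ← hG _ _ h3]
    refine ⟨hpQ, (mem_filter.1 h1).2.2.2 p hpQ (lt_of_le_of_lt (card_le_card ?_) (hA p hp))⟩
    intro q hq
    rw [mem_filter] at hq ⊢
    exact ⟨(h4 q).1 hq.2.2, hq.2.1⟩
  have hq0 : (0 : ℝ) < (Q σ₀).card := by exact_mod_cast hQpos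
  have hr0 : (0 : ℝ) < r := by exact_mod_cast hr
  have hfrac : ((Q σ₀ \ G σ₀).card : ℝ) ≤ (1 - 1 / r) * (Q σ₀).card := by
    rw [card_sdiff_of_subset (hGQ _), Nat.cast_sub (card_le_card (hGQ _)), sub_mul, one_mul,
      one_div_mul_eq_div]
    have : ((Q σ₀).card : ℝ) / r ≤ (G σ₀).card := by
      rw [div_le_iff₀ hr0, mul_comm]; exact_mod_cast hle
    linarith
  refine le_trans (Nat.cast_le.2 (card_le_card hsub)) ?_
  have hb : ((F.filter fun σ => ∀ p ∈ A, σ p ∈ Q σ₀ \ G σ₀).card : ℝ) * ((Q σ₀).card : ℝ) ^ N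
      ≤ ((Q σ₀ \ G σ₀).card : ℝ) ^ N * F.card := by
    rw [hAN] at hbound
    have h : ((F.filter fun σ => ∀ p ∈ A, σ p ∈ Q σ₀ \ G σ₀).card) * ((Q σ₀).card) ^ N
        ≤ ((Q σ₀ \ G σ₀).card) ^ N * F.card := by convert hbound
    exact_mod_cast h
  refine le_of_mul_le_mul_right (hb.trans ?_) (pow_pos hq0 N)
  calc _ ≤ ((1 - 1 / r) * (Q σ₀).card : ℝ) ^ N * F.card := by gcongr
    _ = _ := by rw [mul_pow]; ring

/-- Let `c σ` depend only on the values of `σ` at positions outside `insert t W`. Suppose that every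
value gets a class `ν` among `k` ones and a score `ρ`, both depending on `c σ`. The probability that
the value at `t` beats all values of its class at the positions in `W` is at most
`k / (|W| + 1)`. -/
theorem card_record_mul_le {α γ : Type*} [Fintype α] [DecidableEq α] {k : ℕ} (W : Finset α) (t : α)
    (ht : t ∉ W) (c : Perm α → γ) (ν : γ → α → Fin k) (ρ : γ → α → ℝ≥0)
    (hc : ∀ (σ : Perm α), ∀ s ∈ W, c (σ * swap t s) = c σ) :
    (univ.filter fun σ : Perm α => ∀ p ∈ W, ν (c σ) (σ p) = ν (c σ) (σ t) →
      ρ (c σ) (σ p) < ρ (c σ) (σ t)).card * (W.card + 1) ≤ k * Fintype.card (Perm α) := by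
  set S := univ.filter fun σ : Perm α => ∀ p ∈ W, ν (c σ) (σ p) = ν (c σ) (σ t) →
      ρ (c σ) (σ p) < ρ (c σ) (σ t) with hS
  set R : Perm α → α → Prop := fun σ s => ∀ u ∈ insert t W, u ≠ s →
    ν (c σ) (σ u) = ν (c σ) (σ s) → ρ (c σ) (σ u) < ρ (c σ) (σ s) with hR
  classical
  -- By exchangeability, all positions of `insert t W` are equally likely to carry a strict record:
  -- the swap of `t` and `s` preserves `c`.
  have h1 : ∀ s ∈ insert t W, (univ.filter fun σ : Perm α => R σ s).card = S.card := by
    intro s hs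
    have hc' : ∀ σ : Perm α, c (σ * swap t s) = c σ := by
      intro σ
      rcases mem_insert.1 hs with rfl | hs
      · rw [swap_self]; rfl
      · exact hc σ s hs
    refine card_equiv (Equiv.mulRight (swap t s)) fun σ => ?_
    simp only [mem_filter, mem_univ, true_and, hS, hR, Equiv.coe_mulRight, hc', Perm.mul_apply,
      swap_apply_left]
    constructor
    · intro h p hp hν
      have hpt : p ≠ t := fun e => ht (e ▸ hp)
      refine h _ ?_ ?_ hν
      · rcases eq_or_ne p s with rfl | hps
        · simp
        · rw [swap_apply_of_ne_of_ne hpt hps]; exact mem_insert_of_mem hp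
      · intro e
        exact hpt ((swap t s).injective (e.trans (swap_apply_left t s).symm))
    · intro h u hu hus hν
      rcases eq_or_ne u t with rfl | hut
      · have := h s ((mem_insert.1 hs).resolve_left (fun e => hus e.symm))
        rw [swap_apply_right] at this
        exact this hν
      · have := h u ((mem_insert.1 hu).resolve_left hut)
        rw [swap_apply_of_ne_of_ne hut hus] at this
        exact this hν
  -- Two strict records of the same class would each beat the other.
  have h2 : ∀ σ : Perm α, ((insert t W).filter fun s => R σ s).card ≤ k := by
    intro σ
    calc _ ≤ (univ : Finset (Fin k)).card := by
          refine card_le_card_of_injOn (fun s => ν (c σ) (σ s)) (fun _ _ => mem_coe.2 (mem_univ _)) ?_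
          intro s hs s' hs' e
          obtain ⟨hs, hRs⟩ := mem_filter.1 hs
          obtain ⟨hs', hRs'⟩ := mem_filter.1 hs'
          by_contra hne
          exact lt_asymm (hRs s' hs' (Ne.symm hne) e.symm) (hRs' s hs hne e)
      _ = k := by simp
  calc S.card * (W.card + 1)
      = ∑ s ∈ insert t W, (univ.filter fun σ : Perm α => R σ s).card := by
        rw [sum_congr rfl h1, sum_const, card_insert_of_notMem ht, smul_eq_mul, mul_comm]
    _ = ∑ σ : Perm α, ((insert t W).filter fun s => R σ s).card :=
        sum_card_bipartiteAbove_eq_sum_card_bipartiteBelow (fun s (σ : Perm α) => R σ s)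
    _ ≤ ∑ _σ : Perm α, k := sum_le_sum fun σ _ => h2 σ
    _ = _ := by rw [sum_const, card_univ, smul_eq_mul, mul_comm]

/-! ### Deterministic cost analysis for representative samples. -/

theorem exists_card_mul_le_sum {ι : Type*} {F : Finset ι} (hF : F.Nonempty) (f : ι → ℝ) :
    ∃ v ∈ F, F.card * f v ≤ ∑ w ∈ F, f w := by
  obtain ⟨v, hv, hmin⟩ := exists_min_image F f hF
  exact ⟨v, hv, by simpa using card_nsmul_le_sum F f (f v) hmin⟩

/-- All but a sixth of the points have at most six times the average value. -/
theorem five_mul_card_le_six_mul_card_filter {ι : Type*} (F : Finset ι) (f : ι → ℝ)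
    (hf : ∀ v ∈ F, 0 ≤ f v) :
    5 * F.card ≤ 6 * (F.filter fun v => F.card * f v ≤ 6 * ∑ w ∈ F, f w).card := by
  have hsum : 0 ≤ ∑ w ∈ F, f w := sum_nonneg hf
  set b := (F.filter fun v => ¬ F.card * f v ≤ 6 * ∑ w ∈ F, f w) with hb
  have hadd : (F.filter fun v => F.card * f v ≤ 6 * ∑ w ∈ F, f w).card + b.card = F.card :=
    card_filter_add_card_filter_not _
  suffices h : 6 * b.card ≤ F.card by omega
  rcases hsum.eq_or_lt with h0 | h0
  · have : b = ∅ := by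
      refine filter_eq_empty_iff.2 fun v hv => ?_
      rw [not_not, (sum_eq_zero_iff_of_nonneg hf).1 h0.symm v hv]
      simpa using hsum
    simp [this]
  · have h1 : (b.card : ℝ) * (6 * ∑ w ∈ F, f w) ≤ F.card * ∑ w ∈ F, f w := by
      calc (b.card : ℝ) * (6 * ∑ w ∈ F, f w) = ∑ _v ∈ b, (6 * ∑ w ∈ F, f w) := by simp
        _ ≤ ∑ v ∈ b, F.card * f v :=
            sum_le_sum fun v hv => (not_le.1 (mem_filter.1 hv).2).le
        _ ≤ ∑ v ∈ F, F.card * f v :=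
            sum_le_sum_of_subset_of_nonneg (filter_subset _ _) fun v hv _ =>
              mul_nonneg (Nat.cast_nonneg _) (hf v hv)
        _ = _ := by rw [mul_sum]
    have h2 : (6 * b.card : ℝ) ≤ F.card := by
      refine le_of_mul_le_mul_right ?_ h0
      linarith
    exact_mod_cast h2

/-- If at least half of `C` lies in `V` and `S` has at most `k - 1` times as many points as `C`, then
one of `k` cells of `V` contains a substantial part of `C` and not too many points of `S`. -/
theorem exists_cell_of_card_le {ι : Type*} [DecidableEq ι] {k : ℕ} (hk : 2 ≤ k) (ν : ι → Fin k)
    (C V S : Finset ι) (hCV : C.card ≤ 2 * (C ∩ V).card) (hSC : S.card ≤ (k - 1) * C.card) :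
    ∃ i, C.card ≤ 10 * k * ((V.filter fun v => ν v = i) ∩ C).card ∧
      2 * ((V.filter fun v => ν v = i) ∩ S).card
        ≤ 5 * (k - 1) * ((V.filter fun v => ν v = i) ∩ C).card := by
  by_contra! hcon
  obtain ⟨l, rfl⟩ : ∃ l, k = l + 1 := ⟨k - 1, by omega⟩
  have hl : (1 : ℝ) ≤ l := by exact_mod_cast (by omega : 1 ≤ l)
  simp only [add_tsub_cancel_right] at hcon hSC
  -- If every cell fails, then each `|Q ∩ C|` is below one of the two terms. Summed over the cells,
  -- these are at most `|C| / 10` and `2|C| / 5`, in total `|C| / 2`, which contradicts `hCV`.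
  have hlt : ∀ i : Fin (l + 1), (((V.filter fun v => ν v = i) ∩ C).card : ℝ)
      < C.card / (10 * (l + 1)) + 2 * ((V.filter fun v => ν v = i) ∩ S).card / (5 * l) := by
    intro i
    by_cases h : C.card ≤ 10 * (l + 1) * ((V.filter fun v => ν v = i) ∩ C).card
    · have h1 : (5 * l * ((V.filter fun v => ν v = i) ∩ C).card : ℝ)
        < 2 * ((V.filter fun v => ν v = i) ∩ S).card := by exact_mod_cast hcon i h
      have h2 : (((V.filter fun v => ν v = i) ∩ C).card : ℝ)
          < 2 * ((V.filter fun v => ν v = i) ∩ S).card / (5 * l) := by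
        rw [lt_div_iff₀ (by positivity)]; linarith
      have h3 : (0 : ℝ) ≤ C.card / (10 * (l + 1)) := by positivity
      linarith
    · have h1 : (10 * (l + 1) * ((V.filter fun v => ν v = i) ∩ C).card : ℝ) < C.card := by
        exact_mod_cast not_le.1 h
      have h2 : (((V.filter fun v => ν v = i) ∩ C).card : ℝ) < C.card / (10 * (l + 1)) := by
        rw [lt_div_iff₀ (by positivity)]; linarith
      have h3 : (0 : ℝ) ≤ 2 * ((V.filter fun v => ν v = i) ∩ S).card / (5 * l) := by positivity
      linarith
  have hfib : ∀ B : Finset ι, ∑ i, ((V.filter fun v => ν v = i) ∩ B).card = (B ∩ V).card := by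
    intro B
    rw [card_eq_sum_card_fiberwise (f := ν) (t := univ) (fun _ _ => mem_coe.2 (mem_univ _))]
    refine sum_congr rfl fun i _ => congrArg card ?_
    ext v; simp only [mem_inter, mem_filter]; tauto
  have hsum := sum_lt_sum_of_nonempty (s := (univ : Finset (Fin (l + 1)))) ⟨0, mem_univ _⟩
    fun i _ => hlt i
  rw [sum_add_distrib, sum_const, card_univ, Fintype.card_fin, ← sum_div, ← mul_sum, nsmul_eq_mul,
    ← Nat.cast_sum, ← Nat.cast_sum, hfib, hfib] at hsum
  have h1 : ((l + 1 : ℕ) : ℝ) * ((C.card : ℝ) / (10 * (l + 1))) = C.card / 10 := by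
    push_cast; field_simp
  have h2 : (2 * ((S ∩ V).card : ℝ)) / (5 * l) ≤ 2 * C.card / 5 := by
    have : ((S ∩ V).card : ℝ) ≤ l * C.card := by
      exact_mod_cast (card_le_card inter_subset_left).trans hSC
    rw [div_le_div_iff₀ (by positivity) (by norm_num)]
    linarith
  have h3 : (C.card : ℝ) ≤ 2 * (C ∩ V).card := by exact_mod_cast hCV
  linarith

/-- If the centers `c` serve a substantial part of a cluster `C` with center `o` well, then they serve
all of `C` well. -/
theorem sum_nearest_le_of_sample {X ι : Type*} [DecidableEq ι] {k : ℕ} {D A M O : ℝ}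
    {r : X → X → ℝ} (hD : 1 ≤ D) (hr : ∀ u v, 0 ≤ r u v) (hsymm : ∀ u v, r u v = r v u)
    (htri : ∀ u v w, r u v ≤ D * (r u w + r w v)) {x : ι → X} {c : Fin k → X} {ν : ι → Fin k}
    (hν : ∀ v i, r (x v) (c (ν v)) ≤ r (x v) (c i)) {o : X} {C V : Finset ι}
    (hM : 0 ≤ M) (hCV : (C.card : ℝ) ≤ M * (C ∩ V).card)
    (hV : ∑ v ∈ V, r (x v) (c (ν v)) ≤ A * O) (hC : ∑ v ∈ C, r (x v) o ≤ O) :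
    ∑ v ∈ C, r (x v) (c (ν v)) ≤ (D + D ^ 2 * (M * (A + 1))) * O := by
  have hD0 : 0 ≤ D := by linarith
  rcases (C ∩ V).eq_empty_or_nonempty with h0 | hne
  · rw [h0] at hCV
    have hC0 : C.card = 0 := by
      have : (C.card : ℝ) ≤ 0 := by simpa using hCV
      exact_mod_cast le_antisymm this (Nat.cast_nonneg _)
    have hO : 0 ≤ O := (sum_nonneg fun v _ => hr _ _).trans hC
    have hAO : 0 ≤ A * O := (sum_nonneg fun v _ => hr _ _).trans hV
    rw [card_eq_zero.1 hC0, sum_empty]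
    nlinarith [mul_nonneg hD0 hO, mul_nonneg (mul_nonneg (sq_nonneg D) hM) (add_nonneg hAO hO)]
  -- A sampled point of `C` with at most average combined distance to its center and to `o`. Every
  -- `v ∈ C` reaches the center of `y` through `o` and `y`.
  obtain ⟨y, -, hy⟩ := exists_card_mul_le_sum hne fun v => r (x v) (c (ν v)) + r (x v) o
  have hy' : (C ∩ V).card * (r (x y) (c (ν y)) + r (x y) o) ≤ (A + 1) * O := by
    refine hy.trans ?_
    rw [sum_add_distrib]
    have h1 : ∑ v ∈ C ∩ V, r (x v) (c (ν v)) ≤ A * O :=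
      (sum_le_sum_of_subset_of_nonneg inter_subset_right fun _ _ _ => hr _ _).trans hV
    have h2 : ∑ v ∈ C ∩ V, r (x v) o ≤ O :=
      (sum_le_sum_of_subset_of_nonneg inter_subset_left fun _ _ _ => hr _ _).trans hC
    linarith
  have hyC : C.card * (r (x y) (c (ν y)) + r (x y) o) ≤ M * ((A + 1) * O) :=
    calc _ ≤ M * (C ∩ V).card * (r (x y) (c (ν y)) + r (x y) o) :=
          mul_le_mul_of_nonneg_right hCV (add_nonneg (hr _ _) (hr _ _))
      _ ≤ _ := by rw [mul_assoc]; exact mul_le_mul_of_nonneg_left hy' hM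
  calc ∑ v ∈ C, r (x v) (c (ν v))
      ≤ ∑ v ∈ C, (D * r (x v) o + D ^ 2 * (r (x y) (c (ν y)) + r (x y) o)) := by
        refine sum_le_sum fun v _ => (hν v (ν y)).trans ((htri _ _ o).trans ?_)
        have := mul_le_mul_of_nonneg_left (htri o (c (ν y)) (x y)) hD0
        rw [hsymm o (x y)] at this
        nlinarith
    _ = D * ∑ v ∈ C, r (x v) o + D ^ 2 * (C.card * (r (x y) (c (ν y)) + r (x y) o)) := by
        rw [sum_add_distrib, mul_sum, sum_const, nsmul_eq_mul]; ring
    _ ≤ D * O + D ^ 2 * (M * ((A + 1) * O)) := by gcongr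
    _ = _ := by ring

/-- The points of a large part of a cell whose distance to the center of the cell is at most six
times the average. -/
noncomputable def closePart {ι : Type*} [DecidableEq ι] (cl : ι → ℝ) (Q L : Finset ι) : Finset ι :=
  (Q ∩ L).filter fun v => (Q ∩ L).card * cl v ≤ 6 * ∑ w ∈ Q ∩ L, cl w

/-- A large cluster `C` has a taken point that is close to its center `o`. -/
theorem exists_taken_near_center {X ι : Type*} [Fintype ι] [DecidableEq ι] {k : ℕ} {D B O : ℝ}
    {r : X → X → ℝ} (hk : 2 ≤ k) (hD : 1 ≤ D) (hr : ∀ u v, 0 ≤ r u v)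
    (hsymm : ∀ u v, r u v = r v u)
    (htri : ∀ u v w, r u v ≤ D * (r u w + r w v)) {x : ι → X} {c : Fin k → X} {ν : ι → Fin k}
    {o : X} {C V L T : Finset ι} (hne : C.Nonempty) (hCL : C ⊆ L)
    (hCV : C.card ≤ 2 * (C ∩ V).card) (hSC : Lᶜ.card ≤ (k - 1) * C.card)
    (hL : ∑ v ∈ L, r (x v) (c (ν v)) ≤ B * O) (hC : ∑ v ∈ C, r (x v) o ≤ O)
    (hT : ∀ i, (V.filter fun v => ν v = i).Nonempty →
      (V.filter fun v => ν v = i).card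
        ≤ 3 * k * (closePart (fun v => r (x v) (c (ν v))) (V.filter fun v => ν v = i) L).card →
      ∃ t ∈ T, t ∈ closePart (fun v => r (x v) (c (ν v))) (V.filter fun v => ν v = i) L) :
    ∃ t ∈ T, C.card * r o (x t) ≤ D ^ 2 * (70 * k * B + 10 * k) * O := by
  set cl : ι → ℝ := fun v => r (x v) (c (ν v)) with hcl
  obtain ⟨i, hi1, hi2⟩ := exists_cell_of_card_le hk ν C V Lᶜ hCV hSC
  set Q := V.filter fun v => ν v = i with hQ
  have hQCpos : 0 < (Q ∩ C).card := by
    rcases Nat.eq_zero_or_pos (Q ∩ C).card with h | h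
    · rw [h] at hi1; exact absurd hi1 (by simpa using hne.ne_empty)
    · exact h
  have hQCL : (Q ∩ C).card ≤ (Q ∩ L).card := card_le_card (inter_subset_inter_left hCL)
  have hG := five_mul_card_le_six_mul_card_filter (Q ∩ L) cl fun v _ => hr _ _
  have hQcard : (Q ∩ L).card + (Q ∩ Lᶜ).card = Q.card := by
    rw [← card_union_of_disjoint, ← inter_union_distrib_left, union_compl, inter_univ]
    exact (disjoint_compl_right (a := L)).mono inter_subset_right inter_subset_right
  -- Origin of the factor `3k`: `|Q| ≤ (1 + 5(k-1)/2) |Q ∩ L|`, and `|Q ∩ L|` is at most `6/5` times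
  -- the size of the close part, so the ratio is at most `6/5 + 3(k-1) ≤ 3k`.
  obtain ⟨t, htT, ht⟩ := hT i ((card_pos.1 hQCpos).mono inter_subset_left) (by
    rw [closePart]
    set g := ((Q ∩ L).filter fun v => (Q ∩ L).card * cl v ≤ 6 * ∑ w ∈ Q ∩ L, cl w).card
    obtain ⟨l, rfl⟩ : ∃ l, k = l + 1 := ⟨k - 1, by omega⟩
    simp only [add_tsub_cancel_right] at hi2
    have : 5 * l * (Q ∩ C).card ≤ 5 * l * (Q ∩ L).card := Nat.mul_le_mul_left _ hQCL
    have h1 : 1 * (Q ∩ L).card ≤ l * (Q ∩ L).card := Nat.mul_le_mul_right _ (by omega)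
    have h2 : l * (5 * (Q ∩ L).card) ≤ l * (6 * g) := Nat.mul_le_mul_left _ hG
    nlinarith)
  obtain ⟨htQL, ht6⟩ := mem_filter.1 ht
  have hνt : ν t = i := (mem_filter.1 (mem_inter.1 htQL).1).2
  obtain ⟨v, hvQC, hv⟩ := exists_card_mul_le_sum (card_pos.1 hQCpos) fun v => cl v + r (x v) o
  have hνv : ν v = i := (mem_filter.1 (mem_inter.1 hvQC).1).2
  have hQLsum : ∑ w ∈ Q ∩ L, cl w ≤ B * O :=
    (sum_le_sum_of_subset_of_nonneg inter_subset_right fun _ _ _ => hr _ _).trans hL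
  have hk0 : (0 : ℝ) ≤ 10 * k := by positivity
  have hi1' : (C.card : ℝ) ≤ 10 * k * (Q ∩ C).card := by exact_mod_cast hi1
  have hQCL' : ((Q ∩ C).card : ℝ) ≤ (Q ∩ L).card := by exact_mod_cast hQCL
  have h1 : C.card * cl t ≤ 10 * k * (6 * (B * O)) :=
    calc C.card * cl t ≤ 10 * k * (Q ∩ C).card * cl t := mul_le_mul_of_nonneg_right hi1' (hr _ _)
      _ ≤ 10 * k * (Q ∩ L).card * cl t := by have := hr (x t) (c (ν t)); gcongr
      _ = 10 * k * ((Q ∩ L).card * cl t) := by ring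
      _ ≤ _ := mul_le_mul_of_nonneg_left (ht6.trans (by gcongr)) hk0
  have h2 : C.card * (cl v + r (x v) o) ≤ 10 * k * ((B + 1) * O) :=
    calc C.card * (cl v + r (x v) o) ≤ 10 * k * (Q ∩ C).card * (cl v + r (x v) o) :=
          mul_le_mul_of_nonneg_right hi1' (add_nonneg (hr _ _) (hr _ _))
      _ = 10 * k * ((Q ∩ C).card * (cl v + r (x v) o)) := by ring
      _ ≤ 10 * k * ((B + 1) * O) := by
          refine mul_le_mul_of_nonneg_left (hv.trans ?_) hk0
          rw [sum_add_distrib]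
          have e1 : ∑ w ∈ Q ∩ C, cl w ≤ B * O :=
            (sum_le_sum_of_subset_of_nonneg (inter_subset_right.trans hCL)
              fun _ _ _ => hr _ _).trans hL
          have e2 : ∑ w ∈ Q ∩ C, r (x w) o ≤ O :=
            (sum_le_sum_of_subset_of_nonneg inter_subset_right fun _ _ _ => hr _ _).trans hC
          linarith
  refine ⟨t, htT, ?_⟩
  have hD0 : 0 ≤ D := by linarith
  -- The route is `o`, `v`, the common cell center, `t`.
  have h3 : r o (x t) ≤ D ^ 2 * (cl v + r (x v) o + cl t) := by
    have e1 := htri o (x t) (x v)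
    have e2 := mul_le_mul_of_nonneg_left (htri (x v) (x t) (c i)) hD0
    have e3 : cl v = r (x v) (c i) := by simp only [hcl, hνv]
    have e4 : cl t = r (c i) (x t) := by simp only [hcl, hνt, hsymm]
    have e5 : D * r (x v) o ≤ D ^ 2 * r (x v) o := by
      refine mul_le_mul_of_nonneg_right ?_ (hr _ _); nlinarith
    rw [hsymm o (x v)] at e1
    rw [e3, e4]
    nlinarith
  calc C.card * r o (x t) ≤ C.card * (D ^ 2 * (cl v + r (x v) o + cl t)) := by gcongr
    _ = D ^ 2 * (C.card * (cl v + r (x v) o) + C.card * cl t) := by ring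
    _ ≤ D ^ 2 * (10 * k * ((B + 1) * O) + 10 * k * (6 * (B * O))) := by gcongr
    _ = _ := by ring

/-- The factor by which the cost of the algorithm exceeds the optimal one, per cluster. -/
noncomputable def clusterFactor (k s M : ℕ) (D A : ℝ) : ℝ :=
  -- In units of the optimal cost, `B` bounds the cost of the sample centers on the large clusters,
  -- and `R` bounds the size of a large cluster times the distance from its center to a taken point.
  -- The two summands belong to large and to small clusters.
  let B := k * (D + D ^ 2 * (M * (A + 1)))
  let R := D ^ 2 * (70 * k * B + 10 * k)
  D * (1 + R) + D * (1 + s * (D ^ 3 * (2 * B + 1 + R)))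

theorem clusterFactor_nonneg (k s M : ℕ) {D A : ℝ} (hD : 0 ≤ D) (hA : 0 ≤ A) :
    0 ≤ clusterFactor k s M D A := by
  simp only [clusterFactor]; positivity

/-- If the samples are representative, then for every optimal cluster there is a taken point that
serves the cluster well. -/
theorem exists_taken_sum_le {X ι : Type*} [Fintype ι] [DecidableEq ι] {k s M : ℕ} {D A : ℝ}
    {r : X → X → ℝ} (hk : 2 ≤ k) (hs : 1 ≤ s) (hD : 1 ≤ D) (hA : 0 ≤ A) (hr : ∀ u v, 0 ≤ r u v)
    (hsymm : ∀ u v, r u v = r v u) (hself : ∀ u, r u u = 0)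
    (htri : ∀ u v w, r u v ≤ D * (r u w + r w v)) {x : ι → X} {c : Fin k → X} {ν : ι → Fin k}
    (hν : ∀ v i, r (x v) (c (ν v)) ≤ r (x v) (c i)) {o : Fin k → ι} {j : ι → Fin k}
    {V₁ V₂ V₃ T L : Finset ι} {O : ℝ} (hO : O = ∑ v, r (x v) (x (o (j v))))
    (hL : L = univ.filter fun v => s ≤ (univ.filter fun w => j w = j v).card)
    (hV₁ : ∑ v ∈ V₁, r (x v) (c (ν v)) ≤ A * O)
    (hlarge : ∀ i, s ≤ (univ.filter fun w => j w = i).card →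
      (univ.filter fun w => j w = i).card ≤ M * ((univ.filter fun w => j w = i) ∩ V₁).card)
    (hhalf : ∀ i, (univ.filter fun w => j w = i).card
      ≤ 2 * ((univ.filter fun w => j w = i) ∩ V₃).card)
    (hV₂ : V₂ ⊆ L) (ho : ∀ i, o i ∈ V₃)
    (hfar : ∀ v ∈ V₃, v ∉ T → ∃ w ∈ V₂, ν w = ν v ∧ r (x v) (c (ν v)) ≤ r (x w) (c (ν w)))
    (hT : ∀ i, (V₃.filter fun v => ν v = i).Nonempty →
      (V₃.filter fun v => ν v = i).card
        ≤ 3 * k * (closePart (fun v => r (x v) (c (ν v))) (V₃.filter fun v => ν v = i) L).card →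
      ∃ t ∈ T, t ∈ closePart (fun v => r (x v) (c (ν v))) (V₃.filter fun v => ν v = i) L)
    (i : Fin k) :
    ∃ t ∈ T, ∑ v ∈ univ.filter (fun w => j w = i), r (x v) (x t) ≤ clusterFactor k s M D A * O := by
  set C : Fin k → Finset ι := fun i => univ.filter fun w => j w = i with hCdef
  set cl : ι → ℝ := fun v => r (x v) (c (ν v)) with hcl
  set B : ℝ := k * (D + D ^ 2 * (M * (A + 1))) with hB
  set R : ℝ := D ^ 2 * (70 * k * B + 10 * k) with hR
  have hD0 : 0 ≤ D := by linarith
  have hB0 : 0 ≤ B := by positivity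
  have hR0 : 0 ≤ R := by positivity
  have hO0 : 0 ≤ O := by rw [hO]; exact sum_nonneg fun _ _ => hr _ _
  have hδ : ∀ i, ∑ v ∈ C i, r (x v) (x (o i)) ≤ O := by
    intro i
    rw [hO]
    calc ∑ v ∈ C i, r (x v) (x (o i)) = ∑ v ∈ C i, r (x v) (x (o (j v))) :=
          sum_congr rfl fun v hv => by rw [(mem_filter.1 hv).2]
      _ ≤ _ := sum_le_sum_of_subset_of_nonneg (subset_univ _) fun _ _ _ => hr _ _
  have hδ' : ∀ v, r (x v) (x (o (j v))) ≤ O := by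
    intro v
    rw [hO]
    exact single_le_sum (f := fun v => r (x v) (x (o (j v)))) (fun _ _ => hr _ _) (mem_univ v)
  have hLC : ∀ i, (C i ∩ L).Nonempty → s ≤ (C i).card := by
    rintro i ⟨v, hv⟩
    obtain ⟨h1, h2⟩ := mem_inter.1 hv
    rw [hL] at h2
    rw [← (mem_filter.1 h1).2]
    exact (mem_filter.1 h2).2
  have hCL : ∀ i, s ≤ (C i).card → C i ⊆ L := by
    intro i hi v hv
    rw [hL, mem_filter, (mem_filter.1 hv).2]
    exact ⟨mem_univ _, hi⟩
  have hsumL : ∑ v ∈ L, cl v ≤ B * O := by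
    calc ∑ v ∈ L, cl v = ∑ i, ∑ v ∈ C i ∩ L, cl v := by
          rw [← sum_fiberwise L j]
          refine sum_congr rfl fun i _ => sum_congr ?_ fun _ _ => rfl
          ext v; simp [hCdef, and_comm]
      _ ≤ ∑ _i : Fin k, (D + D ^ 2 * (M * (A + 1))) * O := by
          refine sum_le_sum fun i _ => ?_
          rcases (C i ∩ L).eq_empty_or_nonempty with h | h
          · rw [h, sum_empty]; positivity
          · refine (sum_le_sum_of_subset_of_nonneg inter_subset_left fun _ _ _ => hr _ _).trans
              (sum_nearest_le_of_sample hD hr hsymm htri hν (Nat.cast_nonneg M) ?_ hV₁ (hδ i))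
            exact_mod_cast hlarge i (hLC i h)
      _ = B * O := by rw [sum_const, card_univ, Fintype.card_fin, nsmul_eq_mul, hB]; ring
  -- At most `k - 1` clusters are small, since `C i` is not, and each of them has fewer than `s ≤ |C
  -- i|` points.
  have hcompl : ∀ i, s ≤ (C i).card → Lᶜ.card ≤ (k - 1) * (C i).card := by
    intro i hi
    calc Lᶜ.card = ∑ i' ∈ univ.erase i, (Lᶜ.filter fun v => j v = i').card := by
          refine card_eq_sum_card_fiberwise fun v hv => ?_
          rw [mem_coe, mem_compl] at hv
          refine mem_coe.2 (mem_erase.2 ⟨?_, mem_univ _⟩)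
          rintro rfl
          exact hv (hCL _ hi (by simp [hCdef]))
      _ ≤ ∑ i' ∈ univ.erase i, s := by
          refine sum_le_sum fun i' _ => ?_
          rcases (Lᶜ.filter fun v => j v = i').eq_empty_or_nonempty with h | ⟨v, hv⟩
          · simp [h]
          · obtain ⟨h1, rfl⟩ := mem_filter.1 hv
            have h2 : ¬ s ≤ (C (j v)).card := by
              simpa [hL] using h1
            exact (card_le_card (fun w hw => by simp_all)).trans (not_le.1 h2).le
      _ = (k - 1) * s := by simp
      _ ≤ _ := Nat.mul_le_mul_left _ hi
  have hbig : ∀ i, s ≤ (C i).card →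
      ∃ t ∈ T, (C i).card * r (x (o i)) (x t) ≤ R * O := fun i hi =>
    exists_taken_near_center hk hD hr hsymm htri (card_pos.1 (by omega)) (hCL i hi) (hhalf i)
      (hcompl i hi) hsumL (hδ i) hT
  have hfinish : ∀ t b, (C i).card * r (x (o i)) (x t) ≤ b * O →
      ∑ v ∈ C i, r (x v) (x t) ≤ D * (1 + b) * O := by
    intro t b hb
    calc ∑ v ∈ C i, r (x v) (x t) ≤ ∑ v ∈ C i, D * (r (x v) (x (o i)) + r (x (o i)) (x t)) :=
          sum_le_sum fun v _ => htri _ _ _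
      _ = D * (∑ v ∈ C i, r (x v) (x (o i)) + (C i).card * r (x (o i)) (x t)) := by
          rw [← mul_sum, sum_add_distrib, sum_const, nsmul_eq_mul]
      _ ≤ D * (O + b * O) := by gcongr; exact hδ i
      _ = _ := by ring
  have hK1 : D * (1 + R) ≤ clusterFactor k s M D A := by
    have : 0 ≤ D * (1 + s * (D ^ 3 * (2 * B + 1 + R))) := by positivity
    simp only [clusterFactor]
    linarith
  have hK2 : D * (1 + s * (D ^ 3 * (2 * B + 1 + R))) ≤ clusterFactor k s M D A := by
    have : 0 ≤ D * (1 + R) := by positivity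
    simp only [clusterFactor]
    linarith
  by_cases hi : s ≤ (C i).card
  · obtain ⟨t, ht, h⟩ := hbig i hi
    exact ⟨t, ht, (hfinish t R h).trans (by gcongr)⟩
  have hcard : ((C i).card : ℝ) ≤ s := by exact_mod_cast (not_le.1 hi).le
  by_cases hoT : o i ∈ T
  · refine ⟨o i, hoT, (hfinish _ (s * (D ^ 3 * (2 * B + 1 + R))) ?_).trans (by gcongr)⟩
    rw [hself, mul_zero]; positivity
  -- The center of a small cluster was not taken, hence is not far: `w` in the second sample is at
  -- least as distant from their common cell center. The route is `o i`, cell center, `w`, `o (j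
  -- w)`, `t`, with links of length at most `B * O`, `B * O`, `O` and `R * O`.
  obtain ⟨w, hw, hνw, hle⟩ := hfar _ (ho i) hoT
  have hwL := hV₂ hw
  have hwj : s ≤ (C (j w)).card := by
    rw [hL] at hwL; exact (mem_filter.1 hwL).2
  obtain ⟨t, ht, h⟩ := hbig _ hwj
  refine ⟨t, ht, (hfinish t (s * (D ^ 3 * (2 * B + 1 + R))) ?_).trans (by gcongr)⟩
  have h1 : cl w ≤ B * O := (single_le_sum (f := cl) (fun _ _ => hr _ _) hwL).trans hsumL
  have h2 : r (x (o (j w))) (x t) ≤ R * O := by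
    refine le_trans ?_ h
    have : (1 : ℝ) ≤ (C (j w)).card := by exact_mod_cast hs.trans hwj
    nlinarith [hr (x (o (j w))) (x t)]
  have h3 : r (x (o i)) (x t) ≤ D ^ 3 * (2 * B + 1 + R) * O := by
    have e1 := htri (x (o i)) (x t) (c (ν w))
    have e2 := htri (c (ν w)) (x t) (x w)
    have e3 := htri (x w) (x t) (x (o (j w)))
    rw [hsymm (c (ν w)) (x w)] at e2
    have e4 : r (x (o i)) (c (ν w)) ≤ B * O := by
      rw [hνw]; exact hle.trans h1
    have e5 : r (x w) (x t) ≤ D * (O + R * O) :=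
      e3.trans (mul_le_mul_of_nonneg_left (add_le_add (hδ' w) h2) hD0)
    have e6 : r (c (ν w)) (x t) ≤ D * (B * O + D * (O + R * O)) :=
      e2.trans (mul_le_mul_of_nonneg_left (add_le_add h1 e5) hD0)
    have e7 : r (x (o i)) (x t) ≤ D * (B * O + D * (B * O + D * (O + R * O))) :=
      e1.trans (mul_le_mul_of_nonneg_left (add_le_add e4 e6) hD0)
    have hD3 : D ≤ D ^ 3 := le_self_pow₀ hD (by norm_num)
    have hD23 : D ^ 2 ≤ D ^ 3 := pow_le_pow_right₀ hD (by norm_num)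
    have hBO : 0 ≤ B * O := by positivity
    have e8 := mul_le_mul_of_nonneg_right hD3 hBO
    have e9 := mul_le_mul_of_nonneg_right hD23 hBO
    linarith
  calc (C i).card * r (x (o i)) (x t) ≤ s * (D ^ 3 * (2 * B + 1 + R) * O) :=
        mul_le_mul hcard h3 (hr _ _) (Nat.cast_nonneg s)
    _ = _ := by ring

/-! ### The run of the algorithm in terms of the whole stream. -/

theorem exists_isNearest_iff {X : Type u} {k : ℕ} (hk : 0 < k) (d : X → X → ℝ≥0) (c : Fin k → X)
    (y : X) : ∃ i, ∀ i', IsNearest d c y i' ↔ i' = i := by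
  -- The lexicographic minimum of distance and index encodes the tie rule.
  obtain ⟨i, -, hi⟩ := exists_min_image (univ : Finset (Fin k)) (fun i => toLex (d y (c i), i))
    ⟨⟨0, hk⟩, mem_univ _⟩
  have hi' : ∀ j, d y (c i) < d y (c j) ∨ d y (c i) = d y (c j) ∧ i ≤ j := fun j => by
    simpa [Prod.Lex.le_iff] using hi j (mem_univ j)
  have hnear : IsNearest d c y i := by
    refine ⟨fun j => ?_, fun j hj => ?_⟩
    · rcases hi' j with h | h
      · exact h.le
      · exact h.1.le
    · rcases hi' j with h | h
      · exact h
      · exact absurd h.2 (not_le.2 hj)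
  refine ⟨i, fun i' => ⟨fun h => ?_, fun h => h ▸ hnear⟩⟩
  rcases lt_trichotomy i' i with hlt | heq | hgt
  · exact absurd (hnear.2 i' hlt) (not_lt.2 (h.1 i))
  · exact heq
  · exact absurd (h.2 i hgt) (not_lt.2 (hnear.1 i'))

/-- The index of the center that is nearest to `y`. -/
noncomputable def nearest {X : Type u} {k : ℕ} (hk : 0 < k) (d : X → X → ℝ≥0) (c : Fin k → X)
    (y : X) : Fin k :=
  (exists_isNearest_iff hk d c y).choose

theorem isNearest_iff {X : Type u} {k : ℕ} (hk : 0 < k) (d : X → X → ℝ≥0) (c : Fin k → X)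
    (y : X) (i : Fin k) : IsNearest d c y i ↔ i = nearest hk d c y :=
  (exists_isNearest_iff hk d c y).choose_spec i

theorem dist_nearest_le {X : Type u} {k : ℕ} (hk : 0 < k) (d : X → X → ℝ≥0) (c : Fin k → X)
    (y : X) (i : Fin k) : d y (c (nearest hk d c y)) ≤ d y (c i) :=
  ((isNearest_iff hk d c y _).2 rfl).1 i

/-- For a nonempty cell the default `0` of the fold is harmless: some distance is below `r`, which
forces `0 < r`. -/
theorem rmax_lt_iff {X : Type u} {k : ℕ} {d : X → X → ℝ≥0} {c : Fin k → X} {M : List X}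
    {i : Fin k} {r : ℝ≥0} (h : cell d c M i ≠ []) :
    rmax d c M i < r ↔ ∀ y ∈ cell d c M i, d y (c i) < r := by
  have key : ∀ l : List ℝ≥0, l.foldr max 0 < r ↔ 0 < r ∧ ∀ b ∈ l, b < r := by
    intro l
    induction l with
    | nil => simp
    | cons b l ih => simp [ih]; tauto
  rw [rmax, key]
  simp only [List.mem_map, forall_exists_index, and_imp, forall_apply_eq_imp_iff₂,
    and_iff_right_iff_imp]
  intro hall
  obtain ⟨y, hy⟩ := List.exists_mem_of_ne_nil _ h
  exact lt_of_le_of_lt zero_le (hall y hy)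

/-- For an empty cell the universal statement is vacuous, in agreement with the convention that
every point is then far. Being far thus means being a strict record, the form needed for
exchangeability. -/
theorem isFar_iff_forall {X : Type u} {k : ℕ} {d : X → X → ℝ≥0} {c : Fin k → X} {M : List X}
    {i : Fin k} {y : X} :
    IsFar d c M i y ↔ ∀ z ∈ M, IsNearest d c z i → d z (c i) < d y (c i) := by
  have hcell : ∀ z, z ∈ cell d c M i ↔ z ∈ M ∧ IsNearest d c z i := by
    intro z; simp [cell]
  rw [IsFar]
  by_cases h : cell d c M i = []
  · simp only [h, true_or, true_iff]
    intro z hz hi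
    have := (hcell z).2 ⟨hz, hi⟩
    rw [h] at this
    exact absurd this (List.not_mem_nil)
  · simp only [h, false_or, rmax_lt_iff h, hcell, and_imp]

theorem mem_take_drop_ofFn {X : Type u} {n : ℕ} (s : Fin n → X) (a b : ℕ) (y : X) :
    y ∈ ((List.ofFn s).drop a).take b ↔ ∃ p : Fin n, a ≤ p.1 ∧ p.1 < a + b ∧ s p = y := by
  rw [List.mem_iff_getElem]
  constructor
  · rintro ⟨q, hq, rfl⟩
    rw [List.length_take, List.length_drop, List.length_ofFn] at hq
    exact ⟨⟨a + q, by omega⟩, by simp, by simp; omega, by simp⟩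
  · rintro ⟨p, h1, h2, rfl⟩
    refine ⟨p - a, ?_, ?_⟩
    · rw [List.length_take, List.length_drop, List.length_ofFn]; omega
    · simp [Nat.add_sub_cancel' h1]

/-- A value is far if and only if it beats all values of its cell in the second sample. -/
theorem isFar_take_drop_ofFn_iff {X : Type u} {k n : ℕ} (hk : 0 < k) {d : X → X → ℝ≥0}
    {c : Fin k → X} (s : Fin n → X) (a b : ℕ) (i : Fin k) (y : X) :
    IsFar d c (((List.ofFn s).drop a).take b) i y ↔
      ∀ p ∈ univ.filter (fun p : Fin n => a ≤ p.1 ∧ p.1 < a + b),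
        nearest hk d c (s p) = i → d (s p) (c i) < d y (c i) := by
  simp only [isFar_iff_forall, mem_take_drop_ofFn, mem_filter, mem_univ, true_and,
    isNearest_iff hk, forall_exists_index, and_imp]
  constructor
  · intro h p h1 h2 h3; exact h _ p h1 h2 rfl h3.symm
  · rintro h _ p h1 h2 rfl h3; exact h p h1 h2 h3.symm

open Classical in
/-- The counter of a center is the number of points that have been taken as close points. -/
theorem closeCounter_eq_card {X : Type u} {k n : ℕ} (hk : 0 < k) (d : X → X → ℝ≥0) (c : Fin k → X)
    (i : Fin k) (s : Fin n → X) (m t : ℕ) (ht : t ≤ n) :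
    closeCounter d c i (((List.ofFn s).take t).drop m) =
      (univ.filter fun q : Fin n => m ≤ q.1 ∧ q.1 < t ∧ nearest hk d c (s q) = i ∧
        (closeCounter d c i (((List.ofFn s).take q).drop m) : ℝ)
          ≤ 3 * k * Real.log (40 * k)).card := by
  induction t with
  | zero => simp [closeCounter]
  | succ t ih =>
    have ih := ih (by omega)
    have htn : t < n := by omega
    rcases lt_or_ge t m with hlt | hge
    · rw [List.drop_of_length_le (by simp; omega), closeCounter, List.foldl_nil, eq_comm,
        card_eq_zero, filter_eq_empty_iff]
      intro q _ h; omega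
    have hlist : ((List.ofFn s).take (t + 1)).drop m
        = ((List.ofFn s).take t).drop m ++ [s ⟨t, htn⟩] := by
      rw [List.take_add_one, List.drop_append_of_le_length (by simp; omega)]
      simp [htn]
    rw [hlist, closeCounter, List.foldl_append, ← closeCounter]
    simp only [List.foldl_cons, List.foldl_nil, isNearest_iff hk]
    have hfilter : (univ.filter fun q : Fin n => m ≤ q.1 ∧ q.1 < t + 1 ∧
        nearest hk d c (s q) = i ∧ (closeCounter d c i (((List.ofFn s).take q).drop m) : ℝ)
          ≤ 3 * k * Real.log (40 * k)) =
      (univ.filter fun q : Fin n => m ≤ q.1 ∧ q.1 < t ∧ nearest hk d c (s q) = i ∧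
        (closeCounter d c i (((List.ofFn s).take q).drop m) : ℝ)
          ≤ 3 * k * Real.log (40 * k)) ∪
      (if i = nearest hk d c (s ⟨t, htn⟩) ∧
        (closeCounter d c i (((List.ofFn s).take t).drop m) : ℝ) ≤ 3 * k * Real.log (40 * k)
        then {⟨t, htn⟩} else ∅) := by
      ext q
      simp only [mem_filter, mem_univ, true_and, mem_union]
      rcases lt_trichotomy q.1 t with h | h | h
      · have : q ≠ ⟨t, htn⟩ := fun e => by simp [e] at h
        split_ifs <;> simp [this, h, h.trans (Nat.lt_succ_self t)]
      · obtain rfl : q = ⟨t, htn⟩ := Fin.ext h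
        split_ifs with h'
        · simp [hge, h'.1.symm, h'.2]
        · simp only [lt_irrefl, false_and, and_false, notMem_empty, or_self, iff_false]
          exact fun h3 => h' ⟨h3.2.2.1.symm, h3.2.2.2⟩
      · have : q ≠ ⟨t, htn⟩ := fun e => by simp [e] at h
        have h' : ¬ q.1 < t + 1 := by omega
        split_ifs <;> simp [this, h.le, h']
    rw [hfilter]
    split_ifs with h
    · rw [card_union_of_disjoint (by simp), ih, card_singleton]
    · rw [union_empty, ih]

theorem closeCounter_le {X : Type u} {k : ℕ} (d : X → X → ℝ≥0) (c : Fin k → X) (i : Fin k)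
    (l : List X) : closeCounter d c i l ≤ ⌊3 * k * Real.log (40 * k)⌋₊ + 1 := by
  classical
  suffices h : ∀ m : ℕ, m ≤ ⌊3 * k * Real.log (40 * k)⌋₊ + 1 → l.foldl (fun (m : ℕ) y =>
      if IsNearest d c y i ∧ ((m : ℕ) : ℝ) ≤ 3 * k * Real.log (40 * k) then m + 1 else m) m
        ≤ ⌊3 * k * Real.log (40 * k)⌋₊ + 1 by
    exact h 0 (Nat.zero_le _)
  induction l with
  | nil => intro m hm; exact hm
  | cons y l ih =>
    intro m hm
    rw [List.foldl_cons]
    refine ih _ ?_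
    split_ifs with h
    · exact Nat.succ_le_succ (Nat.le_floor h.2)
    · exact hm

theorem take_ofFn_take {X : Type u} {n : ℕ} (s : Fin n → X) {a t : ℕ} (h : a ≤ t) :
    ((List.ofFn s).take t).take a = (List.ofFn s).take a := by
  rw [List.take_take, min_eq_left h]

theorem drop_take_take {X : Type u} {n : ℕ} (s : Fin n → X) {a b t : ℕ} (h : a + b ≤ t) :
    (((List.ofFn s).take t).drop a).take b = ((List.ofFn s).drop a).take b := by
  rw [List.drop_take, List.take_take, min_eq_left (by omega)]

theorem OnlineAlg.mem_taken_iff {X : Type u} (alg : OnlineAlg X) {n : ℕ} (s : Fin n → X)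
    (t : Fin n) : t ∈ alg.taken s ↔ alg n ((List.ofFn s).take t) (s t) := by
  classical
  rw [OnlineAlg.taken, mem_filter]
  exact and_iff_right (mem_univ t)

/-- From time `m₁ + m₂` on, the past contains both samples completely, so the centers and thresholds
are those of the whole stream and do not depend on `t`. -/
theorem mem_taken_threePhase_iff {X : Type u} {k n : ℕ} (hk : 0 < k) (d : X → X → ℝ≥0)
    (off : List X → Fin k → X) (s : Fin n → X) {m₁ m₂ : ℕ} (hm₁ : m₁ = n / (10 ^ 2 * k))
    (hm₂ : m₂ = n / (10 ^ 5 * k ^ 3)) (h0 : m₁ ≠ 0) {c : Fin k → X}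
    (hc : c = off ((List.ofFn s).take m₁)) (t : Fin n) :
    t ∈ (threePhase d k off).taken s ↔ m₁ + m₂ ≤ t.1 ∧
      ((∀ p ∈ univ.filter (fun p : Fin n => m₁ ≤ p.1 ∧ p.1 < m₁ + m₂),
        nearest hk d c (s p) = nearest hk d c (s t) →
          d (s p) (c (nearest hk d c (s t))) < d (s t) (c (nearest hk d c (s t)))) ∨
      (closeCounter d c (nearest hk d c (s t)) (((List.ofFn s).take t).drop (m₁ + m₂)) : ℝ)
        ≤ 3 * k * Real.log (40 * k)) := by
  have hlen : ((List.ofFn s).take t).length = t.1 := by simp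
  rw [OnlineAlg.mem_taken_iff]
  simp only [threePhase, ← hm₁, ← hm₂, h0, false_or, hlen]
  refine and_congr_right fun hmt => ?_
  rw [take_ofFn_take s (by omega), drop_take_take s hmt, ← hc]
  simp only [isNearest_iff hk, exists_eq_left, isFar_take_drop_ofFn_iff hk]

/-- All points are taken if there are few of them. -/
theorem taken_threePhase_of_eq_zero {X : Type u} {k n : ℕ} (d : X → X → ℝ≥0)
    (off : List X → Fin k → X) (s : Fin n → X) (h0 : n / (10 ^ 2 * k) = 0) :
    (threePhase d k off).taken s = univ := by
  ext t
  rw [OnlineAlg.mem_taken_iff]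
  simp only [threePhase, h0, true_or, mem_univ]

open Classical in
/-- The taken points are the far points and at most `3 k log (40 k) + 1` close points per center. -/
theorem card_taken_threePhase_le {X : Type u} {k n : ℕ} (hk : 0 < k) (d : X → X → ℝ≥0)
    (off : List X → Fin k → X) (s : Fin n → X) {m₁ m₂ : ℕ} (hm₁ : m₁ = n / (10 ^ 2 * k))
    (hm₂ : m₂ = n / (10 ^ 5 * k ^ 3)) (h0 : m₁ ≠ 0) {c : Fin k → X}
    (hc : c = off ((List.ofFn s).take m₁)) :
    ((threePhase d k off).taken s).card ≤
      (univ.filter fun t : Fin n => m₁ + m₂ ≤ t.1 ∧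
        ∀ p ∈ univ.filter (fun p : Fin n => m₁ ≤ p.1 ∧ p.1 < m₁ + m₂),
          nearest hk d c (s p) = nearest hk d c (s t) →
          d (s p) (c (nearest hk d c (s p))) < d (s t) (c (nearest hk d c (s t)))).card
      + k * (⌊3 * k * Real.log (40 * k)⌋₊ + 1) := by
  set F := univ.filter fun t : Fin n => m₁ + m₂ ≤ t.1 ∧
        ∀ p ∈ univ.filter (fun p : Fin n => m₁ ≤ p.1 ∧ p.1 < m₁ + m₂),
          nearest hk d c (s p) = nearest hk d c (s t) →
          d (s p) (c (nearest hk d c (s p))) < d (s t) (c (nearest hk d c (s t)))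
  set H : Fin k → Finset (Fin n) := fun i => univ.filter fun q : Fin n =>
    m₁ + m₂ ≤ q.1 ∧ q.1 < n ∧ nearest hk d c (s q) = i ∧
      (closeCounter d c i (((List.ofFn s).take q).drop (m₁ + m₂)) : ℝ)
          ≤ 3 * k * Real.log (40 * k)
  have hsub : (threePhase d k off).taken s ⊆ F ∪ univ.biUnion H := by
    intro t ht
    obtain ⟨h1, h2⟩ := (mem_taken_threePhase_iff hk d off s hm₁ hm₂ h0 hc t).1 ht
    rcases h2 with h2 | h2
    · refine mem_union_left _ (mem_filter.2 ⟨mem_univ _, h1, fun p hp hν => ?_⟩)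
      rw [hν]; exact h2 p hp hν
    · exact mem_union_right _ (mem_biUnion.2 ⟨_, mem_univ _,
        mem_filter.2 ⟨mem_univ _, h1, t.2, rfl, h2⟩⟩)
  refine (card_le_card hsub).trans ((card_union_le _ _).trans (Nat.add_le_add_left ?_ _))
  refine card_biUnion_le.trans ?_
  calc ∑ i, (H i).card ≤ ∑ _i : Fin k, (⌊3 * k * Real.log (40 * k)⌋₊ + 1) := by
        refine sum_le_sum fun i _ => ?_
        rw [← closeCounter_eq_card hk d c i s (m₁ + m₂) n le_rfl]
        exact closeCounter_le d c i _
    _ = _ := by simp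

/-- A point of the third phase with few predecessors in its cell is taken. -/
theorem mem_taken_threePhase_of_card_lt {X : Type u} {k n : ℕ} (hk : 0 < k) (d : X → X → ℝ≥0)
    (off : List X → Fin k → X) (s : Fin n → X) {m₁ m₂ : ℕ} (hm₁ : m₁ = n / (10 ^ 2 * k))
    (hm₂ : m₂ = n / (10 ^ 5 * k ^ 3)) (h0 : m₁ ≠ 0) {c : Fin k → X}
    (hc : c = off ((List.ofFn s).take m₁)) (t : Fin n) (ht : m₁ + m₂ ≤ t.1)
    (hcard : (univ.filter fun q : Fin n => q < t ∧ m₁ + m₂ ≤ q.1 ∧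
      nearest hk d c (s q) = nearest hk d c (s t)).card < ⌊3 * k * Real.log (40 * k)⌋₊ + 1) :
    t ∈ (threePhase d k off).taken s := by
  classical
  -- The counter is at most the number of earlier phase 3 points of the cell. The test is
  -- non-strict, so it still passes when the counter equals the floor; hence the `+ 1` in `hcard`.
  refine (mem_taken_threePhase_iff hk d off s hm₁ hm₂ h0 hc t).2 ⟨ht, Or.inr ?_⟩
  have hk1 : (1 : ℝ) ≤ k := by exact_mod_cast hk
  have hlog : 0 ≤ Real.log (40 * k) := Real.log_nonneg (by linarith)
  rw [closeCounter_eq_card hk d c _ s (m₁ + m₂) t t.2.le]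
  refine le_trans (Nat.cast_le.2 (le_trans (card_le_card ?_) (Nat.lt_succ_iff.1 hcard)))
    (Nat.floor_le (by positivity))
  intro q hq
  simp only [mem_filter, mem_univ, true_and] at hq ⊢
  exact ⟨hq.2.1, hq.1, hq.2.2.1⟩

/-! ### The offline guarantee on the first sample. -/

/-- The centers that the offline algorithm returns for a sample are, up to a constant factor, as good
as any other `k` centers. -/
theorem sum_dist_nearest_off_le {X : Type u} {k : ℕ} (hk : 0 < k) {D a : ℝ≥0} {d : X → X → ℝ≥0}
    (hd : IsDCost D d) {off : List X → Fin k → X} (hoff : IsOfflineApprox d k a off) {M : List X}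
    (hM : M ≠ []) (z : Fin k → X) (j : Fin M.length → Fin k) :
    ∑ p, d (M.get p) (off M (nearest hk d (off M) (M.get p)))
      ≤ a * (2 * D) * ∑ p, d (M.get p) (z (j p)) := by
  classical
  have hpos : 0 < M.length := List.length_pos_iff.2 hM
  -- The `z i` need not belong to the sample, whereas `optCost` admits only sample points. Replacing
  -- `z i` by the sample point of its class closest to it costs the factor `2 * D`.
  have hrep : ∀ i : Fin k, ∃ q : Fin M.length, ∀ p, j p = i →
      d (M.get q) (z i) ≤ d (M.get p) (z i) := by
    intro i
    rcases (univ.filter fun p => j p = i).eq_empty_or_nonempty with h | h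
    · exact ⟨⟨0, hpos⟩, fun p hp => absurd hp (filter_eq_empty_iff.1 h (mem_univ p))⟩
    · obtain ⟨q, -, hq⟩ := exists_min_image _ (fun p => d (M.get p) (z i)) h
      exact ⟨q, fun p hp => hq p (mem_filter.2 ⟨mem_univ _, hp⟩)⟩
  choose q hq using hrep
  have h1 : (∑ p, (d (M.get p) (off M (nearest hk d (off M) (M.get p))) : ℝ≥0∞))
      ≤ cost d M.get (Set.range (off M)) := by
    refine sum_le_sum fun p _ => le_iInf₂ ?_
    rintro _ ⟨i, rfl⟩
    exact ENNReal.coe_le_coe.2 (dist_nearest_le hk d (off M) (M.get p) i)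
  have h2 : optCost d k M.get ≤ ∑ p, ((2 * D * d (M.get p) (z (j p)) : ℝ≥0) : ℝ≥0∞) := by
    refine (iInf_le _ q).trans (sum_le_sum fun p _ => ?_)
    refine (iInf₂_le (M.get (q (j p))) ⟨j p, rfl⟩).trans (ENNReal.coe_le_coe.2 ?_)
    calc d (M.get p) (M.get (q (j p)))
        ≤ D * (d (M.get p) (z (j p)) + d (z (j p)) (M.get (q (j p)))) := hd.triangle _ _ _
      _ ≤ D * (d (M.get p) (z (j p)) + d (M.get p) (z (j p))) := by
          rw [hd.symm (z (j p))]; gcongr; exact hq _ p rfl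
      _ = _ := by ring
  have h3 := h1.trans ((hoff M hM).2.trans (mul_le_mul_right h2 (a : ℝ≥0∞)))
  have h4 : (((∑ p, d (M.get p) (off M (nearest hk d (off M) (M.get p))) : ℝ≥0)) : ℝ≥0∞)
      ≤ ((a * ∑ p, 2 * D * d (M.get p) (z (j p)) : ℝ≥0) : ℝ≥0∞) := by
    push_cast at h3 ⊢; exact h3
  refine (ENNReal.coe_le_coe.1 h4).trans (le_of_eq ?_)
  rw [← mul_sum]; ring

/-- The bound of `sum_dist_nearest_off_le` for the first `m` points of a stream. -/
theorem sum_prefix_dist_nearest_off_le {X : Type u} {k n m : ℕ} (hk : 0 < k) {D a : ℝ≥0}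
    {d : X → X → ℝ≥0} (hd : IsDCost D d) {off : List X → Fin k → X}
    (hoff : IsOfflineApprox d k a off) (s : Fin n → X) (hm : 0 < m) (hmn : m ≤ n) {c : Fin k → X}
    (hc : c = off ((List.ofFn s).take m)) (z : Fin k → X) (j : Fin n → Fin k) :
    ∑ p ∈ univ.filter (fun p : Fin n => p.1 < m), d (s p) (c (nearest hk d c (s p)))
      ≤ a * (2 * D) * ∑ p, d (s p) (z (j p)) := by
  subst hc
  set M := (List.ofFn s).take m with hMdef
  have hlen : M.length = m := by simp [hMdef, hmn]
  have hM : M ≠ [] := by rw [← List.length_pos_iff, hlen]; exact hm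
  have hle : M.length ≤ n := hlen.trans_le hmn
  have hget : ∀ p, M.get p = s (p.castLE hle) := by intro p; simp [hMdef]; rfl
  have h := sum_dist_nearest_off_le hk hd hoff hM z (fun p => j (p.castLE hle))
  simp only [hget] at h
  have hmap : ∀ f : Fin n → ℝ≥0, ∑ p : Fin M.length, f (p.castLE hle)
      = ∑ p ∈ univ.filter (fun p : Fin n => p.1 < m), f p := by
    intro f
    refine (sum_map univ (Fin.castLEEmb hle) f).symm.trans (sum_congr ?_ fun _ _ => rfl)
    ext p
    simp only [mem_map, mem_univ, true_and, mem_filter]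
    constructor
    · rintro ⟨q, rfl⟩; exact q.2.trans_eq hlen
    · intro hp; exact ⟨⟨p, hp.trans_eq hlen.symm⟩, rfl⟩
  rw [hmap fun p => d (s p) (off M (nearest hk d (off M) (s p))),
    hmap fun p => d (s p) (z (j p))] at h
  exact h.trans (mul_le_mul_right (sum_le_sum_of_subset (filter_subset _ _)) _)

/-! ### Windows of the random order and sampling bounds. -/

/-- The positions from `a` to `b - 1`. -/
def positions (n a b : ℕ) : Finset (Fin n) := univ.filter fun p => a ≤ p.1 ∧ p.1 < b

theorem mem_positions {n a b : ℕ} {p : Fin n} : p ∈ positions n a b ↔ a ≤ p.1 ∧ p.1 < b := by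
  simp [positions]

theorem card_positions {n a b : ℕ} (hb : b ≤ n) : (positions n a b).card = b - a := by
  rw [← Nat.card_Ico, ← card_map Fin.valEmbedding]
  congr 1
  ext p
  simp only [mem_map, mem_positions, Fin.valEmbedding_apply, mem_Ico]
  exact ⟨fun ⟨q, hq, e⟩ => e ▸ hq, fun hp => ⟨⟨p, hp.2.trans_le hb⟩, hp, rfl⟩⟩

/-- The values that arrive at the positions from `a` to `b - 1`. -/
def arrivals {n : ℕ} (σ : Perm (Fin n)) (a b : ℕ) : Finset (Fin n) :=
  (positions n a b).map σ.toEmbedding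

theorem mem_arrivals {n a b : ℕ} {σ : Perm (Fin n)} {v : Fin n} :
    v ∈ arrivals σ a b ↔ a ≤ (σ.symm v).1 ∧ (σ.symm v).1 < b := by
  simp only [arrivals, mem_map, mem_positions, coe_toEmbedding]
  exact ⟨fun ⟨q, hq, e⟩ => by simpa [← e] using hq, fun h => ⟨σ.symm v, h, by simp⟩⟩

theorem card_inter_arrivals {n : ℕ} (σ : Perm (Fin n)) (a b : ℕ) (C : Finset (Fin n)) :
    (C ∩ arrivals σ a b).card = ((positions n a b).filter fun p => σ p ∈ C).card := by
  rw [← card_map (s := (positions n a b).filter fun p => σ p ∈ C) σ.toEmbedding]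
  congr 1
  ext v
  simp only [mem_inter, mem_arrivals, mem_map, mem_filter, mem_positions, coe_toEmbedding]
  constructor
  · rintro ⟨h1, h2⟩; exact ⟨σ.symm v, ⟨h2, by simpa using h1⟩, by simp⟩
  · rintro ⟨p, ⟨h1, h2⟩, rfl⟩; exact ⟨h2, by simpa using h1⟩

/-- The values arriving from `m` on are the complement of the earlier ones. Hence the set of phase 3
values, though not its order, is determined by the first two phases. -/
theorem arrivals_congr {n m : ℕ} {σ τ : Perm (Fin n)} (h : ∀ p : Fin n, p.1 < m → σ p = τ p) :
    arrivals σ m n = arrivals τ m n := by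
  have key : ∀ σ τ : Perm (Fin n), (∀ p : Fin n, p.1 < m → σ p = τ p) →
      arrivals σ m n ⊆ arrivals τ m n := by
    intro σ τ h v hv
    rw [mem_arrivals] at hv ⊢
    refine ⟨?_, (τ.symm v).2⟩
    by_contra! hlt
    have e := h _ hlt
    rw [apply_symm_apply, ← eq_symm_apply] at e
    rw [e] at hlt
    omega
  exact (key σ τ h).antisymm (key τ σ fun p hp => (h p hp).symm)

theorem take_ofFn_congr {X : Type u} {n m : ℕ} {s t : Fin n → X}
    (h : ∀ p : Fin n, p.1 < m → s p = t p) :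
    (List.ofFn s).take m = (List.ofFn t).take m := by
  refine List.ext_getElem (by simp) fun i h1 h2 => ?_
  simp only [List.getElem_take, List.getElem_ofFn]
  exact h _ (by simp at h1; exact h1.1)

/-- Markov's inequality for the number of points of `B` among the values at `A`. -/
theorem card_filter_le_card_mul_le {n : ℕ} (A B : Finset (Fin n)) (r l : ℕ) :
    (univ.filter fun σ : Perm (Fin n) => r ≤ l * (A.filter fun p => σ p ∈ B).card).card * r * n
      ≤ l * (A.card * B.card) * Fintype.card (Perm (Fin n)) := by
  have h1 := card_filter_le_mul_le_sum (univ : Finset (Perm (Fin n)))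
    (fun σ => l * (A.filter fun p => σ p ∈ B).card) r
  have h2 := sum_card_filter_mem_mul_le A B
  rw [← mul_sum] at h1
  rw [Fintype.card_fin] at h2
  calc _ ≤ l * (∑ σ : Perm (Fin n), (A.filter fun p => σ p ∈ B).card) * n :=
        Nat.mul_le_mul_right _ h1
    _ = l * ((∑ σ : Perm (Fin n), (A.filter fun p => σ p ∈ B).card) * n) := by ring
    _ ≤ l * (A.card * B.card * Fintype.card (Perm (Fin n))) := Nat.mul_le_mul_left _ h2
    _ = _ := by ring

/-- A set of at least `s` values contributes its share to the values at `A` up to a factor of order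
`s |A| / n`, except with a probability that is exponentially small in `s |A| / n`. -/
theorem card_small_sample_le {n s : ℕ} (hs : 1 ≤ s) (A C : Finset (Fin n)) (hsC : s ≤ C.card) :
    ((univ.filter fun σ : Perm (Fin n) =>
      4 * s * (A.filter fun p => σ p ∈ C).card < C.card).card : ℝ)
      ≤ 2 * Real.exp (-(s * A.card / n)) * Fintype.card (Perm (Fin n)) := by
  -- `C` contains `b` disjoint blocks of `s` values, and each block is missed with probability at
  -- most `(1 - s/n) ^ |A|`. A sample with fewer than `|C| / (4s) < b / 2` points of `C` misses at
  -- least half of the blocks; Markov's inequality for the number of missed blocks gives the factor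
  -- `2`.
  set b := C.card / s with hb
  have hb1 : 1 ≤ b := (Nat.one_le_div_iff (by omega)).2 hsC
  have hbs : b * s ≤ C.card := Nat.div_mul_le_self _ _
  have hbC : C.card < 2 * (b * s) := by
    have := Nat.lt_div_mul_add (a := C.card) (show 0 < s by omega)
    rw [← hb] at this
    have : 1 * s ≤ b * s := Nat.mul_le_mul_right _ hb1
    omega
  have hn : 0 < n := by
    have := C.card_le_univ
    rw [Fintype.card_fin] at this; omega
  have hsn : s ≤ n := by
    have := C.card_le_univ
    rw [Fintype.card_fin] at this; omega
  obtain ⟨e⟩ : Nonempty (Fin b × Fin s ↪ C) :=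
    Function.Embedding.nonempty_of_card_le (by simpa using hbs)
  set Bl : Fin b → Finset (Fin n) := fun β => univ.map
    ⟨fun i : Fin s => (e (β, i) : Fin n), fun i i' h => by simpa using h⟩ with hBl
  have hBlcard : ∀ β, (Bl β).card = s := fun β => by simp [hBl]
  set f : Perm (Fin n) → ℕ := fun σ =>
    (univ.filter fun β => ∀ p ∈ A, σ p ∈ (Bl β)ᶜ).card with hf
  have himp : ∀ σ : Perm (Fin n), 4 * s * (A.filter fun p => σ p ∈ C).card < C.card →
      b ≤ 2 * f σ := by
    intro σ hσ
    have hadd : f σ + (univ.filter fun β => ¬ ∀ p ∈ A, σ p ∈ (Bl β)ᶜ).card = b := by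
      rw [hf, card_filter_add_card_filter_not, card_univ, Fintype.card_fin]
    have hhit : (univ.filter fun β => ¬ ∀ p ∈ A, σ p ∈ (Bl β)ᶜ).card
        ≤ (A.filter fun p => σ p ∈ C).card := by
      have hex : ∀ β, ∃ p : Fin n, (¬ ∀ p ∈ A, σ p ∈ (Bl β)ᶜ) → p ∈ A ∧ σ p ∈ Bl β := by
        intro β
        by_cases h : ∀ p ∈ A, σ p ∈ (Bl β)ᶜ
        · exact ⟨⟨0, hn⟩, fun h' => absurd h h'⟩
        · push Not at h
          obtain ⟨p, hp, h⟩ := h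
          exact ⟨p, fun _ => ⟨hp, by simpa using h⟩⟩
      choose g hg using hex
      refine card_le_card_of_injOn g ?_ ?_
      · intro β hβ
        obtain ⟨h1, h2⟩ := hg β (mem_filter.1 hβ).2
        refine mem_coe.2 (mem_filter.2 ⟨h1, ?_⟩)
        obtain ⟨i, -, hi⟩ := mem_map.1 h2
        rw [← hi]; exact (e (β, i)).2
      · intro β hβ β' hβ' hgg
        obtain ⟨-, h2⟩ := hg β (mem_filter.1 hβ).2
        obtain ⟨-, h2'⟩ := hg β' (mem_filter.1 hβ').2
        rw [hgg] at h2
        obtain ⟨i, -, hi⟩ := mem_map.1 h2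
        obtain ⟨i', -, hi'⟩ := mem_map.1 h2'
        have h3 : e (β, i) = e (β', i') := Subtype.ext (hi.trans hi'.symm)
        exact (Prod.ext_iff.1 (e.injective h3)).1
    have h4 : s * (4 * (A.filter fun p => σ p ∈ C).card) < s * (2 * b) := by
      calc _ = 4 * s * (A.filter fun p => σ p ∈ C).card := by ring
        _ < C.card := hσ
        _ < 2 * (b * s) := hbC
        _ = _ := by ring
    have h5 := Nat.lt_of_mul_lt_mul_left h4
    omega
  have hsum : ∑ σ : Perm (Fin n), f σ
      = ∑ β, (univ.filter fun σ : Perm (Fin n) => ∀ p ∈ A, σ p ∈ (Bl β)ᶜ).card :=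
    (sum_card_bipartiteAbove_eq_sum_card_bipartiteBelow
      (fun β (σ : Perm (Fin n)) => ∀ p ∈ A, σ p ∈ (Bl β)ᶜ)).symm
  have hn0 : (0 : ℝ) < n := by exact_mod_cast hn
  have hβ : ∀ β, ((univ.filter fun σ : Perm (Fin n) => ∀ p ∈ A, σ p ∈ (Bl β)ᶜ).card : ℝ)
      ≤ Real.exp (-(s * A.card / n)) * Fintype.card (Perm (Fin n)) := by
    intro β
    have h := card_perm_forall_mem_mul_pow_le A (Bl β)ᶜ
    rw [card_compl, hBlcard, Fintype.card_fin] at h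
    have h' : ((univ.filter fun σ : Perm (Fin n) => ∀ p ∈ A, σ p ∈ (Bl β)ᶜ).card : ℝ)
        * (n : ℝ) ^ A.card ≤ ((n : ℝ) - s) ^ A.card * Fintype.card (Perm (Fin n)) := by
      rw [← Nat.cast_sub hsn]
      have h'' : (univ.filter fun σ : Perm (Fin n) => ∀ p ∈ A, σ p ∈ (Bl β)ᶜ).card
        * n ^ A.card ≤ (n - s) ^ A.card * Fintype.card (Perm (Fin n)) := by convert h
      exact_mod_cast h''
    have hexp : ((n : ℝ) - s) ^ A.card ≤ Real.exp (-(s * A.card / n)) * (n : ℝ) ^ A.card := by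
      have h1 : (n : ℝ) - s ≤ Real.exp (-(s / n)) * n := by
        have h2 := Real.add_one_le_exp (-(s / n : ℝ))
        calc (n : ℝ) - s = (-(s / n : ℝ) + 1) * n := by field_simp; ring
          _ ≤ _ := by gcongr
      have h0 : (0 : ℝ) ≤ (n : ℝ) - s := by
        rw [sub_nonneg]; exact_mod_cast hsn
      calc ((n : ℝ) - s) ^ A.card ≤ (Real.exp (-(s / n)) * n) ^ A.card := by gcongr
        _ = _ := by rw [mul_pow, ← Real.exp_nat_mul]; congr 2; ring
    refine le_of_mul_le_mul_right (h'.trans ?_) (pow_pos hn0 A.card)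
    calc _ ≤ Real.exp (-(s * A.card / n)) * (n : ℝ) ^ A.card * Fintype.card (Perm (Fin n)) := by
          gcongr
      _ = _ := by ring
  have hmarkov := card_filter_le_mul_le_sum (univ : Finset (Perm (Fin n))) (fun σ => 2 * f σ) b
  rw [← mul_sum, hsum] at hmarkov
  have hle : (univ.filter fun σ : Perm (Fin n) =>
      4 * s * (A.filter fun p => σ p ∈ C).card < C.card).card
      ≤ (univ.filter fun σ : Perm (Fin n) => b ≤ 2 * f σ).card :=
    card_le_card fun σ hσ => mem_filter.2 ⟨mem_univ _, himp σ (mem_filter.1 hσ).2⟩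
  have hb0 : (0 : ℝ) < b := by exact_mod_cast hb1
  refine le_of_mul_le_mul_right ?_ hb0
  calc ((univ.filter fun σ : Perm (Fin n) =>
          4 * s * (A.filter fun p => σ p ∈ C).card < C.card).card : ℝ) * b
      ≤ (univ.filter fun σ : Perm (Fin n) => b ≤ 2 * f σ).card * b := by gcongr
    _ ≤ 2 * ∑ β, ((univ.filter fun σ : Perm (Fin n) => ∀ p ∈ A, σ p ∈ (Bl β)ᶜ).card : ℝ) := by
        exact_mod_cast hmarkov
    _ ≤ 2 * ∑ _β : Fin b, Real.exp (-(s * A.card / n)) * Fintype.card (Perm (Fin n)) := by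
        gcongr; exact hβ _
    _ = _ := by rw [sum_const, card_univ, Fintype.card_fin, nsmul_eq_mul]; ring

/-! ### Numerical estimates and phase lengths. -/

/-- From `1 - x ≤ exp (-x)` and an exponent exceeding `3k log (40k)`. This fixes the length of the
counters: a union bound over the `k` cells leaves `1/40`. -/
theorem one_sub_pow_le {k : ℕ} (hk : 2 ≤ k) :
    (1 - 1 / ((3 * k : ℕ) : ℝ)) ^ (⌊3 * k * Real.log (40 * k)⌋₊ + 1) ≤ 1 / (40 * k) := by
  have hk0 : (2 : ℝ) ≤ k := by exact_mod_cast hk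
  set N := ⌊3 * k * Real.log (40 * k)⌋₊ + 1 with hN
  have hlt : 3 * k * Real.log (40 * k) < N := by
    rw [hN]; push_cast; exact Nat.lt_floor_add_one _
  have h1 : (1 : ℝ) - 1 / ((3 * k : ℕ) : ℝ) ≤ Real.exp (-(1 / (3 * k))) := by
    have := Real.add_one_le_exp (-(1 / (3 * k : ℝ)))
    push_cast; linarith
  have h0 : (0 : ℝ) ≤ 1 - 1 / ((3 * k : ℕ) : ℝ) := by
    rw [sub_nonneg, div_le_one (by push_cast; linarith)]; push_cast; linarith
  calc (1 - 1 / ((3 * k : ℕ) : ℝ)) ^ N ≤ Real.exp (-(1 / (3 * k))) ^ N := by gcongr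
    _ = Real.exp (-(N / (3 * k))) := by rw [← Real.exp_nat_mul]; congr 1; ring
    _ ≤ Real.exp (-Real.log (40 * k)) := by
        rw [Real.exp_le_exp, neg_le_neg_iff, le_div_iff₀ (by linarith)]; linarith
    _ = _ := by rw [Real.exp_neg, Real.exp_log (by linarith), one_div]

theorem mul_exp_neg_le {k : ℕ} (hk : 2 ≤ k) : 200 * k * Real.exp (-(5 * k)) ≤ 1 := by
  have h100 : (100 : ℝ) ≤ Real.exp 5 := by
    have h := Real.exp_one_gt_d9
    have : Real.exp 5 = Real.exp 1 ^ 5 := by rw [← Real.exp_nat_mul]; norm_num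
    rw [this]
    calc (100 : ℝ) ≤ 2.7 ^ 5 := by norm_num
      _ ≤ _ := by gcongr; linarith
  have hpow : ∀ l : ℕ, 2 ≤ l → (200 * l : ℝ) ≤ 100 ^ l := by
    intro l hl
    induction l, hl using Nat.le_induction with
    | base => norm_num
    | succ l hl ih =>
      have : (2 : ℝ) ≤ l := by exact_mod_cast hl
      rw [pow_succ]; push_cast; linarith
  rw [Real.exp_neg, ← div_eq_mul_inv, div_le_one (Real.exp_pos _)]
  calc (200 * k : ℝ) ≤ 100 ^ k := hpow k hk
    _ ≤ Real.exp 5 ^ k := by gcongr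
    _ = _ := by rw [← Real.exp_nat_mul]; congr 1; ring

/-- The constant `90` instead of `100` makes room for `m₂`. The lower bound on `m₁` uses `m₁ ≠ 0`,
by which rounding down at most halves. The bound with `m₂ + 1` also covers an empty second sample.
-/
theorem phase_lengths {k n m₁ m₂ : ℕ} (hk : 2 ≤ k) (hm₁ : m₁ = n / (10 ^ 2 * k))
    (hm₂ : m₂ = n / (10 ^ 5 * k ^ 3)) (h0 : m₁ ≠ 0) :
    90 * (k * (m₁ + m₂)) ≤ n ∧ 100 * (m₂ * (1000 * k ^ 3)) ≤ n ∧ n ≤ 200 * k * m₁ ∧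
      n ≤ (m₂ + 1) * (10 ^ 5 * k ^ 3) ∧ m₁ + m₂ ≤ n ∧ 0 < n := by
  have h1 : m₁ * (10 ^ 2 * k) ≤ n := by rw [hm₁]; exact Nat.div_mul_le_self _ _
  have h2 : m₂ * (10 ^ 5 * k ^ 3) ≤ n := by rw [hm₂]; exact Nat.div_mul_le_self _ _
  have h3 : n < m₁ * (10 ^ 2 * k) + 10 ^ 2 * k := by
    rw [hm₁]; exact Nat.lt_div_mul_add (by positivity)
  have h4 : n < m₂ * (10 ^ 5 * k ^ 3) + 10 ^ 5 * k ^ 3 := by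
    rw [hm₂]; exact Nat.lt_div_mul_add (by positivity)
  have hk3 : 4 * (m₂ * k) ≤ m₂ * k ^ 3 := by
    have : 2 ^ 2 ≤ k ^ 2 := Nat.pow_le_pow_left hk 2
    calc 4 * (m₂ * k) = m₂ * (2 ^ 2 * k) := by ring
      _ ≤ m₂ * (k ^ 2 * k) := by gcongr
      _ = _ := by ring
  have h5 : 1 * (10 ^ 2 * k) ≤ m₁ * (10 ^ 2 * k) := Nat.mul_le_mul_right _ (by omega)
  have h6 : 90 * (k * (m₁ + m₂)) ≤ n := by nlinarith
  have h7 : 1 * (m₁ + m₂) ≤ k * (m₁ + m₂) := Nat.mul_le_mul_right _ (by omega)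
  refine ⟨h6, by linarith, by linarith, by linarith, by omega, by omega⟩

/-- The points of the clusters with at least `s` points. -/
def largePart {n k : ℕ} (j : Fin n → Fin k) (s : ℕ) : Finset (Fin n) :=
  univ.filter fun v => s ≤ (univ.filter fun w => j w = j v).card

theorem card_compl_largePart_le {n k : ℕ} (j : Fin n → Fin k) (s : ℕ) :
    (largePart j s)ᶜ.card ≤ k * s := by
  rw [card_eq_sum_card_fiberwise (f := j) (t := univ) (fun _ _ => mem_coe.2 (mem_univ _))]
  calc _ ≤ ∑ _i : Fin k, s := by
        refine sum_le_sum fun i _ => ?_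
        rcases ((largePart j s)ᶜ.filter fun v => j v = i).eq_empty_or_nonempty with h | ⟨v, hv⟩
        · simp [h]
        · obtain ⟨h1, rfl⟩ := mem_filter.1 hv
          have h2 : ¬ s ≤ (univ.filter fun w => j w = j v).card := by
            simpa [largePart] using h1
          exact (card_le_card (fun w hw => by simp_all)).trans (not_le.1 h2).le
    _ = _ := by simp

theorem card_filter_exists_le {α : Type*} [Fintype α] {k : ℕ} (E : Fin k → α → Prop)
    [∀ i, DecidablePred (E i)] [DecidablePred fun a => ∃ i, E i a] :
    (univ.filter fun a => ∃ i, E i a).card ≤ ∑ i, (univ.filter (E i)).card := by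
  classical
  refine (card_le_card fun a ha => ?_).trans card_biUnion_le
  obtain ⟨i, hi⟩ := (mem_filter.1 ha).2
  exact mem_biUnion.2 ⟨i, mem_univ _, mem_filter.2 ⟨mem_univ _, hi⟩⟩

theorem mul_card_le_of_mul_card_le_sum {k n b N : ℕ} (hn : 0 < n) {E : ℕ} {f : Fin k → ℕ}
    (hE : E ≤ ∑ i, f i) {l : ℕ} (hf : ∀ i, f i * n ≤ l * N) (hl : b * (k * l) ≤ n) :
    b * E ≤ N := by
  refine Nat.le_of_mul_le_mul_right ?_ hn
  calc b * E * n ≤ b * (∑ i, f i) * n := by gcongr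
    _ = b * ∑ i, f i * n := by rw [mul_assoc, sum_mul]
    _ ≤ b * ∑ _i : Fin k, l * N := Nat.mul_le_mul_left _ (sum_le_sum fun i _ => hf i)
    _ = b * (k * l) * N := by simp; ring
    _ ≤ n * N := by gcongr
    _ = _ := mul_comm _ _

/-! ### Probabilities of the six bad events. -/

section Events

variable {k n m₁ m₂ : ℕ}

/-- Each center misses phase 3 with probability at most `(m₁ + m₂) / n`. A center that arrives in
phase 3 is taken or dominated by the second sample, as small clusters require. -/
theorem card_center_early_le (hk : 2 ≤ k) (hm₁ : m₁ = n / (10 ^ 2 * k))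
    (hm₂ : m₂ = n / (10 ^ 5 * k ^ 3)) (h0 : m₁ ≠ 0) (o : Fin k → Fin n) :
    90 * (univ.filter fun σ : Perm (Fin n) => ∃ i, o i ∉ arrivals σ (m₁ + m₂) n).card
      ≤ Fintype.card (Perm (Fin n)) := by
  obtain ⟨h1, -, -, -, hmn, hn⟩ := phase_lengths hk hm₁ hm₂ h0
  refine mul_card_le_of_mul_card_le_sum hn (card_filter_exists_le _) (l := m₁ + m₂)
    (fun i => ?_) h1
  have h := card_filter_le_card_mul_le (positions n 0 (m₁ + m₂)) {o i} 1 1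
  rw [card_positions hmn, card_singleton] at h
  simp only [mul_one, one_mul, Nat.sub_zero] at h
  refine (Nat.mul_le_mul_right _ (card_le_card fun σ hσ => ?_)).trans h
  have hσ := (mem_filter.1 hσ).2
  rw [mem_arrivals] at hσ
  refine mem_filter.2 ⟨mem_univ _, card_pos.2 ⟨σ.symm (o i), mem_filter.2 ⟨?_, by simp⟩⟩⟩
  rw [mem_positions]
  have := (σ.symm (o i)).2
  omega

/-- The expected share of a cluster in the first two phases is `(m₁ + m₂) / n`; Markov's inequality
at one half, then a union bound. -/
theorem card_cluster_early_le (hk : 2 ≤ k) (hm₁ : m₁ = n / (10 ^ 2 * k))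
    (hm₂ : m₂ = n / (10 ^ 5 * k ^ 3)) (h0 : m₁ ≠ 0) (C : Fin k → Finset (Fin n)) :
    45 * (univ.filter fun σ : Perm (Fin n) =>
      ∃ i, 2 * (C i ∩ arrivals σ (m₁ + m₂) n).card < (C i).card).card
      ≤ Fintype.card (Perm (Fin n)) := by
  obtain ⟨h1, -, -, -, hmn, hn⟩ := phase_lengths hk hm₁ hm₂ h0
  refine mul_card_le_of_mul_card_le_sum hn (card_filter_exists_le _) (l := 2 * (m₁ + m₂))
    (fun i => ?_) (by linarith)
  rcases (C i).card.eq_zero_or_pos with hC | hC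
  · simp [hC]
  have h := card_filter_le_card_mul_le (positions n 0 (m₁ + m₂)) (C i) (C i).card 2
  rw [card_positions hmn, Nat.sub_zero] at h
  have hle : (univ.filter fun σ : Perm (Fin n) =>
      2 * (C i ∩ arrivals σ (m₁ + m₂) n).card < (C i).card).card
      ≤ (univ.filter fun σ : Perm (Fin n) => (C i).card ≤
        2 * ((positions n 0 (m₁ + m₂)).filter fun p => σ p ∈ C i).card).card := by
    refine card_le_card fun σ hσ => mem_filter.2 ⟨mem_univ _, ?_⟩
    have hσ := (mem_filter.1 hσ).2
    rw [← card_inter_arrivals]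
    have hcup : C i ⊆ (C i ∩ arrivals σ 0 (m₁ + m₂)) ∪ (C i ∩ arrivals σ (m₁ + m₂) n) := by
      intro v hv
      rw [← inter_union_distrib_left, mem_inter, mem_union, mem_arrivals, mem_arrivals]
      have := (σ.symm v).2
      exact ⟨hv, by omega⟩
    have := (card_le_card hcup).trans (card_union_le _ _)
    omega
  refine Nat.le_of_mul_le_mul_right ?_ hC
  calc _ ≤ (univ.filter fun σ : Perm (Fin n) => (C i).card ≤
        2 * ((positions n 0 (m₁ + m₂)).filter fun p => σ p ∈ C i).card).card * n * (C i).card := by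
        gcongr
    _ = _ := by ring
    _ ≤ _ := h
    _ = _ := by ring

/-- Small clusters have at most `1000 k³` points in total, so the second sample, of length at most
`n / (10⁵ k³)`, contains at most `1/100` of them in expectation. This is why phase 2 is so short. -/
theorem card_small_in_second_le (hk : 2 ≤ k) (hm₁ : m₁ = n / (10 ^ 2 * k))
    (hm₂ : m₂ = n / (10 ^ 5 * k ^ 3)) (h0 : m₁ ≠ 0) (j : Fin n → Fin k) :
    100 * (univ.filter fun σ : Perm (Fin n) =>
      ¬ arrivals σ m₁ (m₁ + m₂) ⊆ largePart j (1000 * k ^ 2)).card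
      ≤ Fintype.card (Perm (Fin n)) := by
  obtain ⟨-, h1, -, -, hmn, hn⟩ := phase_lengths hk hm₁ hm₂ h0
  have h := card_filter_le_card_mul_le (positions n m₁ (m₁ + m₂)) (largePart j (1000 * k ^ 2))ᶜ 1 1
  rw [card_positions hmn] at h
  simp only [mul_one, one_mul, Nat.add_sub_cancel_left] at h
  have hle : (univ.filter fun σ : Perm (Fin n) =>
      ¬ arrivals σ m₁ (m₁ + m₂) ⊆ largePart j (1000 * k ^ 2)).card
      ≤ (univ.filter fun σ : Perm (Fin n) => 1 ≤
        ((positions n m₁ (m₁ + m₂)).filter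
          fun p => σ p ∈ (largePart j (1000 * k ^ 2))ᶜ).card).card := by
    refine card_le_card fun σ hσ => mem_filter.2 ⟨mem_univ _, ?_⟩
    obtain ⟨v, hv, hvL⟩ := not_subset.1 (mem_filter.1 hσ).2
    rw [← card_inter_arrivals]
    exact card_pos.2 ⟨v, mem_inter.2 ⟨mem_compl.2 hvL, hv⟩⟩
  refine Nat.le_of_mul_le_mul_right ?_ hn
  calc _ ≤ 100 * (m₂ * (largePart j (1000 * k ^ 2))ᶜ.card * Fintype.card (Perm (Fin n))) := by
        rw [mul_assoc]; exact Nat.mul_le_mul_left _ ((Nat.mul_le_mul_right _ hle).trans h)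
    _ ≤ 100 * (m₂ * (k * (1000 * k ^ 2)) * Fintype.card (Perm (Fin n))) := by
        gcongr; exact card_compl_largePart_le j _
    _ = 100 * (m₂ * (1000 * k ^ 3)) * Fintype.card (Perm (Fin n)) := by ring
    _ ≤ n * Fintype.card (Perm (Fin n)) := by gcongr
    _ = _ := mul_comm _ _

/-- As `m₁ ≥ n / (200k)`, the exponent `s m₁ / n` is at least `5k`, and `2k exp (-5k) ≤ 1/100` pays
for the union bound. -/
theorem card_cluster_missed_le (hk : 2 ≤ k) (hm₁ : m₁ = n / (10 ^ 2 * k))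
    (hm₂ : m₂ = n / (10 ^ 5 * k ^ 3)) (h0 : m₁ ≠ 0) (C : Fin k → Finset (Fin n)) :
    100 * (univ.filter fun σ : Perm (Fin n) => ∃ i, 1000 * k ^ 2 ≤ (C i).card ∧
      4 * (1000 * k ^ 2) * (C i ∩ arrivals σ 0 m₁).card < (C i).card).card
      ≤ Fintype.card (Perm (Fin n)) := by
  obtain ⟨-, -, h1, -, hmn, hn⟩ := phase_lengths hk hm₁ hm₂ h0
  have hn0 : (0 : ℝ) < n := by exact_mod_cast hn
  have hi : ∀ i, ((univ.filter fun σ : Perm (Fin n) => 1000 * k ^ 2 ≤ (C i).card ∧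
      4 * (1000 * k ^ 2) * (C i ∩ arrivals σ 0 m₁).card < (C i).card).card : ℝ)
      ≤ 2 * Real.exp (-(5 * k)) * Fintype.card (Perm (Fin n)) := by
    intro i
    by_cases hC : 1000 * k ^ 2 ≤ (C i).card
    · have h := card_small_sample_le (Nat.mul_pos (by norm_num) (by positivity))
        (positions n 0 m₁) (C i) hC
      rw [card_positions (by omega), Nat.sub_zero] at h
      simp only [hC, true_and, card_inter_arrivals]
      refine h.trans ?_
      have h2 : (n : ℝ) ≤ 200 * k * m₁ := by exact_mod_cast h1
      have h3 : (5 * k : ℝ) ≤ ((1000 * k ^ 2 : ℕ) : ℝ) * m₁ / n := by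
        rw [le_div_iff₀ hn0]; push_cast
        calc (5 * k * n : ℝ) ≤ 5 * k * (200 * k * m₁) := by gcongr
          _ = _ := by ring
      gcongr
    · simp only [hC, false_and, filter_false, card_empty, Nat.cast_zero]
      positivity
  have h5 : ((univ.filter fun σ : Perm (Fin n) => ∃ i, 1000 * k ^ 2 ≤ (C i).card ∧
      4 * (1000 * k ^ 2) * (C i ∩ arrivals σ 0 m₁).card < (C i).card).card : ℝ)
      ≤ k * (2 * Real.exp (-(5 * k)) * Fintype.card (Perm (Fin n))) := by
    refine (Nat.cast_le.2 (card_filter_exists_le _)).trans ?_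
    rw [Nat.cast_sum]
    refine (sum_le_sum fun i _ => hi i).trans (le_of_eq ?_)
    rw [sum_const, card_univ, Fintype.card_fin, nsmul_eq_mul]
  have h6 := mul_exp_neg_le hk
  have h7 : (100 * (univ.filter fun σ : Perm (Fin n) => ∃ i, 1000 * k ^ 2 ≤ (C i).card ∧
      4 * (1000 * k ^ 2) * (C i ∩ arrivals σ 0 m₁).card < (C i).card).card : ℝ)
      ≤ Fintype.card (Perm (Fin n)) := by
    have h8 := mul_le_mul_of_nonneg_right h6 (Nat.cast_nonneg' (α := ℝ)
      (Fintype.card (Perm (Fin n))))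
    linarith
  exact_mod_cast h7

variable {X : Type u}

/-- The centers computed from the first `m` points of the stream `x ∘ σ`. -/
def sampleCenters (off : List X → Fin k → X) (x : Fin n → X) (m : ℕ) (σ : Perm (Fin n)) :
    Fin k → X :=
  off ((List.ofFn (x ∘ σ)).take m)

theorem sampleCenters_congr (off : List X → Fin k → X) (x : Fin n → X) {m : ℕ}
    {σ τ : Perm (Fin n)} (h : ∀ p : Fin n, p.1 < m → σ p = τ p) :
    sampleCenters off x m σ = sampleCenters off x m τ := by
  rw [sampleCenters, sampleCenters, take_ofFn_congr]
  intro p hp; simp [h p hp]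

-- The centers depend only on positions before `m₁`, so swaps within the second sample and the
-- tested position preserve them and the record bound applies. The expected number of far points is
-- at most `n k / (m₂ + 1) ≤ 10⁵ k⁴`; Markov's inequality loses a factor `100`.
open Classical in
theorem card_many_far_le (hk : 2 ≤ k) (hm₁ : m₁ = n / (10 ^ 2 * k))
    (hm₂ : m₂ = n / (10 ^ 5 * k ^ 3)) (h0 : m₁ ≠ 0) (ν : (Fin k → X) → Fin n → Fin k)
    (ρ : (Fin k → X) → Fin n → ℝ≥0) (off : List X → Fin k → X) (x : Fin n → X) :
    100 * (univ.filter fun σ : Perm (Fin n) => 10 ^ 7 * k ^ 4 ≤ (univ.filter fun t : Fin n =>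
        m₁ + m₂ ≤ t.1 ∧ ∀ p ∈ univ.filter (fun p : Fin n => m₁ ≤ p.1 ∧ p.1 < m₁ + m₂),
          ν (sampleCenters off x m₁ σ) (σ p) = ν (sampleCenters off x m₁ σ) (σ t) →
          ρ (sampleCenters off x m₁ σ) (σ p) < ρ (sampleCenters off x m₁ σ) (σ t)).card).card
      ≤ Fintype.card (Perm (Fin n)) := by
  obtain ⟨-, -, -, h1, hmn, hn⟩ := phase_lengths hk hm₁ hm₂ h0
  set W := univ.filter fun p : Fin n => m₁ ≤ p.1 ∧ p.1 < m₁ + m₂ with hW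
  have hWcard : W.card = m₂ := by
    have := card_positions (a := m₁) hmn
    rwa [Nat.add_sub_cancel_left] at this
  set c := sampleCenters off x m₁
  set far : Fin n → Perm (Fin n) → Prop := fun t σ => ∀ p ∈ W, ν (c σ) (σ p) = ν (c σ) (σ t) →
    ρ (c σ) (σ p) < ρ (c σ) (σ t) with hfar
  have ht : ∀ t : Fin n, (univ.filter fun σ => m₁ + m₂ ≤ t.1 ∧ far t σ).card * (m₂ + 1)
      ≤ k * Fintype.card (Perm (Fin n)) := by
    intro t
    by_cases hmt : m₁ + m₂ ≤ t.1
    · have h := card_record_mul_le W t (by simp [hW]; omega) c ν ρ (fun σ s hs => by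
        refine sampleCenters_congr off x fun p hp => ?_
        rw [Perm.mul_apply, swap_apply_of_ne_of_ne]
        · rintro rfl; omega
        · rintro rfl; have := (mem_filter.1 hs).2.1; omega)
      rw [hWcard] at h
      simp only [hmt, true_and, hfar]
      convert h
    · simp [hmt]
  have hsum : ∑ σ, (univ.filter fun t : Fin n => m₁ + m₂ ≤ t.1 ∧ far t σ).card
      = ∑ t : Fin n, (univ.filter fun σ => m₁ + m₂ ≤ t.1 ∧ far t σ).card :=
    (sum_card_bipartiteAbove_eq_sum_card_bipartiteBelow
      (fun (t : Fin n) σ => m₁ + m₂ ≤ t.1 ∧ far t σ)).symm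
  have hmarkov := card_filter_le_mul_le_sum (univ : Finset (Perm (Fin n)))
    (fun σ => (univ.filter fun t : Fin n => m₁ + m₂ ≤ t.1 ∧ far t σ).card) (10 ^ 7 * k ^ 4)
  rw [hsum] at hmarkov
  set E := (univ.filter fun σ : Perm (Fin n) => 10 ^ 7 * k ^ 4
    ≤ (univ.filter fun t : Fin n => m₁ + m₂ ≤ t.1 ∧ far t σ).card).card
  change 100 * E ≤ _
  have hpos : 0 < (m₂ + 1) * (10 ^ 5 * k ^ 4) := by positivity
  refine Nat.le_of_mul_le_mul_right ?_ hpos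
  calc 100 * E * ((m₂ + 1) * (10 ^ 5 * k ^ 4)) = E * (10 ^ 7 * k ^ 4) * (m₂ + 1) := by ring
    _ ≤ (∑ t : Fin n, (univ.filter fun σ => m₁ + m₂ ≤ t.1 ∧ far t σ).card) * (m₂ + 1) := by gcongr
    _ ≤ ∑ _t : Fin n, k * Fintype.card (Perm (Fin n)) := by
        rw [sum_mul]; exact sum_le_sum fun t _ => ht t
    _ = n * (k * Fintype.card (Perm (Fin n))) := by simp
    _ ≤ (m₂ + 1) * (10 ^ 5 * k ^ 3) * (k * Fintype.card (Perm (Fin n))) := by gcongr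
    _ = _ := by ring

/-- The values of the third phase whose nearest center has the index `i`. -/
noncomputable def lateCell (hk : 0 < k) (d : X → X → ℝ≥0) (off : List X → Fin k → X)
    (x : Fin n → X) (m₁ m₂ : ℕ) (i : Fin k) (σ : Perm (Fin n)) : Finset (Fin n) :=
  (arrivals σ (m₁ + m₂) n).filter fun v => nearest hk d (sampleCenters off x m₁ σ) (x v) = i

/-- The distances to the nearest center. -/
noncomputable def centerDist (hk : 0 < k) (d : X → X → ℝ≥0) (c : Fin k → X) (x : Fin n → X)
    (v : Fin n) : ℝ :=
  d (x v) (c (nearest hk d c (x v)))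

/-- The late cell and its close part are determined by the first two phases, while the order inside
the cell remains uniform. The first `⌊3k log (40k)⌋ + 1` points of the cell are all taken, so
missing the close part means that all of them avoid it. -/
theorem card_close_missed_le (hk : 2 ≤ k) (hk0 : 0 < k) (hm₁ : m₁ = n / (10 ^ 2 * k))
    (hm₂ : m₂ = n / (10 ^ 5 * k ^ 3)) (h0 : m₁ ≠ 0) (d : X → X → ℝ≥0) (off : List X → Fin k → X)
    (x : Fin n → X) (L : Finset (Fin n)) [DecidablePred fun σ : Perm (Fin n) =>
      ∃ i, (lateCell hk0 d off x m₁ m₂ i σ).Nonempty ∧ (lateCell hk0 d off x m₁ m₂ i σ).card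
        ≤ 3 * k * (closePart (centerDist hk0 d (sampleCenters off x m₁ σ) x)
          (lateCell hk0 d off x m₁ m₂ i σ) L).card ∧
        ∀ t ∈ ((threePhase d k off).taken (x ∘ σ)).map σ.toEmbedding,
          t ∉ closePart (centerDist hk0 d (sampleCenters off x m₁ σ) x)
            (lateCell hk0 d off x m₁ m₂ i σ) L] :
    40 * (univ.filter fun σ : Perm (Fin n) =>
      ∃ i, (lateCell hk0 d off x m₁ m₂ i σ).Nonempty ∧ (lateCell hk0 d off x m₁ m₂ i σ).card
        ≤ 3 * k * (closePart (centerDist hk0 d (sampleCenters off x m₁ σ) x)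
          (lateCell hk0 d off x m₁ m₂ i σ) L).card ∧
        ∀ t ∈ ((threePhase d k off).taken (x ∘ σ)).map σ.toEmbedding,
          t ∉ closePart (centerDist hk0 d (sampleCenters off x m₁ σ) x)
            (lateCell hk0 d off x m₁ m₂ i σ) L).card
      ≤ Fintype.card (Perm (Fin n)) := by
  classical
  set Q := lateCell hk0 d off x m₁ m₂ with hQdef
  set G : Fin k → Perm (Fin n) → Finset (Fin n) := fun i σ =>
    closePart (centerDist hk0 d (sampleCenters off x m₁ σ) x) (Q i σ) L with hGdef
  have hQcongr : ∀ i (σ τ : Perm (Fin n)), (∀ p : Fin n, p.1 < m₁ + m₂ → σ p = τ p) →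
      Q i σ = Q i τ := by
    intro i σ τ h
    rw [hQdef, lateCell, lateCell, arrivals_congr h,
      sampleCenters_congr off x fun p hp => h p (by omega)]
  have hGcongr : ∀ i (σ τ : Perm (Fin n)), (∀ p : Fin n, p.1 < m₁ + m₂ → σ p = τ p) →
      G i σ = G i τ := by
    intro i σ τ h
    simp only [hGdef]
    rw [hQcongr i σ τ h, sampleCenters_congr off x fun p hp => h p (by omega)]
  have hi : ∀ i, ((univ.filter fun σ : Perm (Fin n) => (Q i σ).Nonempty ∧
      (Q i σ).card ≤ 3 * k * (G i σ).card ∧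
      ∀ t ∈ ((threePhase d k off).taken (x ∘ σ)).map σ.toEmbedding, t ∉ G i σ).card : ℝ)
      ≤ 1 / (40 * k) * Fintype.card (Perm (Fin n)) := by
    intro i
    have h := card_first_avoid_le (N := ⌊3 * k * Real.log (40 * k)⌋₊ + 1) (r := 3 * k) (by omega)
      (Q i) (G i) (hQcongr i) (hGcongr i)
      (fun σ => (filter_subset _ _).trans inter_subset_left) (fun σ p hp => by
        simpa using (mem_arrivals.1 (mem_filter.1 hp).1).1)
    refine le_trans (Nat.cast_le.2 (card_le_card fun σ hσ => ?_))
      (h.trans (mul_le_mul_of_nonneg_right (one_sub_pow_le hk) (Nat.cast_nonneg _)))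
    obtain ⟨-, h1, h2, h3⟩ := mem_filter.1 hσ
    refine mem_filter.2 ⟨mem_univ _, h1, h2, fun p hp hcard => h3 _ ?_⟩
    refine mem_map.2 ⟨p, ?_, rfl⟩
    have hmem : ∀ q, σ q ∈ Q i σ ↔ m₁ + m₂ ≤ q.1 ∧
        nearest hk0 d (sampleCenters off x m₁ σ) (x (σ q)) = i := by
      intro q
      rw [hQdef, lateCell, mem_filter, mem_arrivals]
      simp
    obtain ⟨hp1, hp2⟩ := (hmem p).1 hp
    refine mem_taken_threePhase_of_card_lt hk0 d off (x ∘ σ) hm₁ hm₂ h0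
      (c := sampleCenters off x m₁ σ) rfl p hp1 (lt_of_le_of_lt (card_le_card fun q hq => ?_) hcard)
    simp only [mem_filter, mem_univ, true_and, Function.comp_apply, hmem] at hq ⊢
    exact ⟨hq.1, hq.2.1, hq.2.2.trans hp2⟩
  have hk' : (0 : ℝ) < k := by exact_mod_cast hk0
  have h5 := (Nat.cast_le (α := ℝ)).2 (card_filter_exists_le fun i (σ : Perm (Fin n)) =>
    (Q i σ).Nonempty ∧ (Q i σ).card ≤ 3 * k * (G i σ).card ∧
      ∀ t ∈ ((threePhase d k off).taken (x ∘ σ)).map σ.toEmbedding, t ∉ G i σ)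
  rw [Nat.cast_sum] at h5
  have h6 := h5.trans (sum_le_sum fun i _ => hi i)
  rw [sum_const, card_univ, Fintype.card_fin, nsmul_eq_mul] at h6
  have h7 : (k : ℝ) * (1 / (40 * k) * Fintype.card (Perm (Fin n)))
      = Fintype.card (Perm (Fin n)) / 40 := by field_simp
  rw [h7, le_div_iff₀ (by norm_num), mul_comm] at h6
  convert (by exact_mod_cast h6 : 40 * (univ.filter fun σ : Perm (Fin n) => ∃ i,
    (Q i σ).Nonempty ∧ (Q i σ).card ≤ 3 * k * (G i σ).card ∧
      ∀ t ∈ ((threePhase d k off).taken (x ∘ σ)).map σ.toEmbedding, t ∉ G i σ).card ≤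
        Fintype.card (Perm (Fin n)))

end Events

/-! ### Assembly of the theorem. -/

theorem cost_range_eq {X : Type u} {ι : Type*} [Fintype ι] {k : ℕ} (hk : 0 < k)
    (d : X → X → ℝ≥0) (x : ι → X) (c : Fin k → X) :
    cost d x (Set.range c) = ((∑ v, d (x v) (c (nearest hk d c (x v))) : ℝ≥0) : ℝ≥0∞) := by
  push_cast
  refine sum_congr rfl fun v _ => le_antisymm (iInf₂_le _ ⟨_, rfl⟩) (le_iInf₂ ?_)
  rintro _ ⟨i, rfl⟩
  exact ENNReal.coe_le_coe.2 (dist_nearest_le hk d c (x v) i)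

theorem exists_optCost_eq {X : Type u} {n k : ℕ} (hn : 0 < n) (hk : 0 < k) (d : X → X → ℝ≥0)
    (x : Fin n → X) : ∃ (o : Fin k → Fin n) (j : Fin n → Fin k),
      optCost d k x = ((∑ v, d (x v) (x (o (j v))) : ℝ≥0) : ℝ≥0∞) := by
  have : Nonempty (Fin k → Fin n) := ⟨fun _ => ⟨0, hn⟩⟩
  obtain ⟨o, ho⟩ := exists_eq_ciInf_of_finite
    (f := fun c : Fin k → Fin n => cost d x (Set.range (x ∘ c)))
  exact ⟨o, fun v => nearest hk d (x ∘ o) (x v), by rw [optCost, ← ho, cost_range_eq hk]; rfl⟩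

/-- The approximation factor of the algorithm. -/
noncomputable def approxFactor (k : ℕ) (D a : ℝ≥0) : ℝ≥0 :=
  k * (clusterFactor k (1000 * k ^ 2) (4 * (1000 * k ^ 2)) D (a * (2 * D))).toNNReal

theorem cost_le_approxFactor_mul {X : Type u} {n k : ℕ} {D a : ℝ≥0} {d : X → X → ℝ≥0}
    (x : Fin n → X) (T : Finset (Fin n)) (o : Fin k → Fin n) (j : Fin n → Fin k)
    (h : ∀ i, ∃ t ∈ T, ∑ v ∈ univ.filter (fun w => j w = i), (d (x v) (x t) : ℝ)
      ≤ clusterFactor k (1000 * k ^ 2) (4 * (1000 * k ^ 2)) D (a * (2 * D))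
        * ∑ v, (d (x v) (x (o (j v))) : ℝ)) :
    cost d x (x '' T) ≤ approxFactor k D a
      * ((∑ v, d (x v) (x (o (j v))) : ℝ≥0) : ℝ≥0∞) := by
  choose t ht hsum using h
  have h1 : cost d x (x '' T) ≤ ((∑ v, d (x v) (x (t (j v))) : ℝ≥0) : ℝ≥0∞) := by
    push_cast
    exact sum_le_sum fun v _ => iInf₂_le _ ⟨_, ht _, rfl⟩
  refine h1.trans ?_
  rw [← ENNReal.coe_mul, ENNReal.coe_le_coe, ← NNReal.coe_le_coe]
  have hK := clusterFactor_nonneg k (1000 * k ^ 2) (4 * (1000 * k ^ 2)) D.coe_nonneg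
    (show (0 : ℝ) ≤ a * (2 * D) by positivity)
  rw [approxFactor]
  push_cast
  rw [Real.coe_toNNReal _ hK, ← sum_fiberwise univ j]
  calc _ ≤ ∑ _i : Fin k, clusterFactor k (1000 * k ^ 2) (4 * (1000 * k ^ 2)) D (a * (2 * D))
        * ∑ v, (d (x v) (x (o (j v))) : ℝ) := by
        refine sum_le_sum fun i _ => le_trans (le_of_eq ?_) (hsum i)
        exact sum_congr rfl fun v hv => by rw [(mem_filter.1 hv).2]
    _ = _ := by rw [sum_const, card_univ, Fintype.card_fin, nsmul_eq_mul, mul_assoc]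

/-- Union bound: `1/90 + 1/45 + 3/100 + 1/40 < 1/10`. -/
theorem ten_mul_card_le_of_cover {α : Type*} [DecidableEq α] {N : ℕ}
    {E e₁ e₂ e₃ e₄ e₅ e₆ : Finset α} (b₁ : 90 * e₁.card ≤ N) (b₂ : 45 * e₂.card ≤ N)
    (b₃ : 100 * e₃.card ≤ N) (b₄ : 100 * e₄.card ≤ N) (b₅ : 40 * e₅.card ≤ N)
    (b₆ : 100 * e₆.card ≤ N)
    (h : ∀ a ∈ E, a ∈ e₁ ∨ a ∈ e₂ ∨ a ∈ e₃ ∨ a ∈ e₄ ∨ a ∈ e₅ ∨ a ∈ e₆) : 10 * E.card ≤ N := by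
  have hsub : E ⊆ e₁ ∪ (e₂ ∪ (e₃ ∪ (e₄ ∪ (e₅ ∪ e₆)))) := fun a ha => by
    simpa only [mem_union] using h a ha
  have h0 := card_le_card hsub
  have h1 := card_union_le e₁ (e₂ ∪ (e₃ ∪ (e₄ ∪ (e₅ ∪ e₆))))
  have h2 := card_union_le e₂ (e₃ ∪ (e₄ ∪ (e₅ ∪ e₆)))
  have h3 := card_union_le e₃ (e₄ ∪ (e₅ ∪ e₆))
  have h4 := card_union_le e₄ (e₅ ∪ e₆)
  have h5 := card_union_le e₅ e₆
  omega

/-- The order `σ` is representative: the optimal centers and at least half of every optimal cluster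
arrive in the third phase, the second sample contains points of large clusters only, the first sample
contains a fair share of every large cluster, and a good point is taken in every cell with many of
them. -/
structure IsRepresentative {X : Type u} {n k : ℕ} (hk : 0 < k) (d : X → X → ℝ≥0)
    (off : List X → Fin k → X) (x : Fin n → X) (o : Fin k → Fin n) (j : Fin n → Fin k)
    (s m₁ m₂ : ℕ) (σ : Perm (Fin n)) : Prop where
  center_late : ∀ i, o i ∈ arrivals σ (m₁ + m₂) n
  half_late : ∀ i, (univ.filter fun w => j w = i).card
    ≤ 2 * ((univ.filter fun w => j w = i) ∩ arrivals σ (m₁ + m₂) n).card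
  second_large : arrivals σ m₁ (m₁ + m₂) ⊆ largePart j s
  first_fair : ∀ i, s ≤ (univ.filter fun w => j w = i).card →
    (univ.filter fun w => j w = i).card
      ≤ 4 * s * ((univ.filter fun w => j w = i) ∩ arrivals σ 0 m₁).card
  close_taken : ∀ i, (lateCell hk d off x m₁ m₂ i σ).Nonempty →
    (lateCell hk d off x m₁ m₂ i σ).card
      ≤ 3 * k * (closePart (centerDist hk d (sampleCenters off x m₁ σ) x)
        (lateCell hk d off x m₁ m₂ i σ) (largePart j s)).card →
    ∃ t ∈ ((threePhase d k off).taken (x ∘ σ)).map σ.toEmbedding,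
      t ∈ closePart (centerDist hk d (sampleCenters off x m₁ σ) x)
        (lateCell hk d off x m₁ m₂ i σ) (largePart j s)

theorem IsRepresentative.cost_le {X : Type u} {n k : ℕ} {D a : ℝ≥0} (hk : 2 ≤ k) (hk0 : 0 < k)
    (hD : 1 ≤ D) {d : X → X → ℝ≥0} (hd : IsDCost D d) {off : List X → Fin k → X}
    (hoff : IsOfflineApprox d k a off) {m₁ m₂ : ℕ} (hm₁ : m₁ = n / (10 ^ 2 * k))
    (hm₂ : m₂ = n / (10 ^ 5 * k ^ 3)) (h0 : m₁ ≠ 0) (x : Fin n → X) {o : Fin k → Fin n}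
    {j : Fin n → Fin k} {σ : Perm (Fin n)}
    (hσ : IsRepresentative hk0 d off x o j (1000 * k ^ 2) m₁ m₂ σ) :
    cost d x ((x ∘ σ) '' ((threePhase d k off).taken (x ∘ σ) : Set (Fin n)))
      ≤ approxFactor k D a * ((∑ v, d (x v) (x (o (j v))) : ℝ≥0) : ℝ≥0∞) := by
  obtain ⟨-, -, -, -, hmn, hn⟩ := phase_lengths hk hm₁ hm₂ h0
  set T := ((threePhase d k off).taken (x ∘ σ)).map σ.toEmbedding with hT
  set c := sampleCenters off x m₁ σ with hc
  have himage : (x ∘ σ) '' ((threePhase d k off).taken (x ∘ σ) : Set (Fin n)) = x '' T := by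
    rw [hT, coe_map, Set.image_comp]; rfl
  rw [himage]
  refine cost_le_approxFactor_mul x T o j ?_
  have hV₁ : ∑ v ∈ arrivals σ 0 m₁, (d (x v) (c (nearest hk0 d c (x v))) : ℝ)
      ≤ (a * (2 * D) : ℝ) * ∑ v, (d (x v) (x (o (j v))) : ℝ) := by
    have h := sum_prefix_dist_nearest_off_le hk0 hd hoff (x ∘ σ) (Nat.pos_of_ne_zero h0)
      (show m₁ ≤ n by omega) (c := c) rfl (x ∘ o) (j ∘ σ)
    have hpos : (univ.filter fun p : Fin n => p.1 < m₁) = positions n 0 m₁ := by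
      ext p; simp [mem_positions]
    have hall : ∑ p, d ((x ∘ σ) p) ((x ∘ o) ((j ∘ σ) p)) = ∑ v, d (x v) (x (o (j v))) :=
      Equiv.sum_comp σ fun v => d (x v) (x (o (j v)))
    rw [hall, hpos] at h
    rw [arrivals, sum_map]
    exact_mod_cast h
  refine exists_taken_sum_le (r := fun u v => (d u v : ℝ)) (c := c)
    (ν := fun v => nearest hk0 d c (x v)) hk (Nat.mul_pos (by norm_num) (by positivity))
    (by exact_mod_cast hD) (by positivity) (fun _ _ => NNReal.coe_nonneg _)
    (fun u v => by rw [hd.symm]) (fun u => by rw [hd.self]; rfl)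
    (fun u v w => by exact_mod_cast hd.triangle u v w)
    (fun v i => by exact_mod_cast dist_nearest_le hk0 d c (x v) i) rfl rfl hV₁ hσ.first_fair
    hσ.half_late hσ.second_large hσ.center_late ?_ hσ.close_taken
  intro v hv hvT
  obtain ⟨p, rfl⟩ := σ.surjective v
  have hp : p ∉ (threePhase d k off).taken (x ∘ σ) := fun h => hvT (mem_map_of_mem _ h)
  have hmp : m₁ + m₂ ≤ p.1 := by simpa using (mem_arrivals.1 hv).1
  rw [mem_taken_threePhase_iff hk0 d off (x ∘ σ) hm₁ hm₂ h0 (c := c) rfl] at hp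
  -- An untaken late point is not a strict record, so some second sample point of its cell is at
  -- least as distant from the center.
  have hp1 := fun h => hp ⟨hmp, Or.inl h⟩
  simp only [Function.comp_apply] at hp1
  by_contra! hcon
  refine hp1 fun q hq hν => ?_
  have h := hcon (σ q) (by simpa [mem_arrivals] using hq) hν
  rw [hν] at h
  exact_mod_cast h

/-- With probability at least `9 / 10`, the order is representative and only few points are far. -/
theorem ten_mul_card_le_of_fails {X : Type u} {n k : ℕ} {D a : ℝ≥0} (hk : 2 ≤ k) (hD : 1 ≤ D)
    {d : X → X → ℝ≥0} (hd : IsDCost D d) {off : List X → Fin k → X}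
    (hoff : IsOfflineApprox d k a off) (h0 : n / (10 ^ 2 * k) ≠ 0) (x : Fin n → X)
    (E : Finset (Perm (Fin n)))
    (hE : ∀ σ ∈ E, ¬ (((threePhase d k off).taken (x ∘ σ)).card
        ≤ 10 ^ 7 * k ^ 4 + k * (⌊3 * k * Real.log (40 * k)⌋₊ + 1) ∧
      cost d x ((x ∘ σ) '' ((threePhase d k off).taken (x ∘ σ) : Set (Fin n)))
        ≤ approxFactor k D a * optCost d k x)) :
    10 * E.card ≤ Fintype.card (Perm (Fin n)) := by
  classical
  have hk0 : 0 < k := by omega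
  obtain ⟨m₁, hm₁⟩ : ∃ m, m = n / (10 ^ 2 * k) := ⟨_, rfl⟩
  obtain ⟨m₂, hm₂⟩ : ∃ m, m = n / (10 ^ 5 * k ^ 3) := ⟨_, rfl⟩
  rw [← hm₁] at h0
  obtain ⟨-, -, -, -, -, hn⟩ := phase_lengths hk hm₁ hm₂ h0
  obtain ⟨o, j, hopt⟩ := exists_optCost_eq hn hk0 d x
  refine ten_mul_card_le_of_cover (card_center_early_le hk hm₁ hm₂ h0 o)
    (card_cluster_early_le hk hm₁ hm₂ h0 fun i => univ.filter fun w => j w = i)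
    (card_small_in_second_le hk hm₁ hm₂ h0 j)
    (card_cluster_missed_le hk hm₁ hm₂ h0 fun i => univ.filter fun w => j w = i)
    (card_close_missed_le hk hk0 hm₁ hm₂ h0 d off x (largePart j (1000 * k ^ 2)))
    (card_many_far_le hk hm₁ hm₂ h0 (fun c v => nearest hk0 d c (x v))
      (fun c v => d (x v) (c (nearest hk0 d c (x v)))) off x) fun σ hσ => ?_
  by_contra! hnot
  simp only [mem_filter, mem_univ, true_and] at hnot
  obtain ⟨h1, h2, h3, h4, h5, h6⟩ := hnot
  push Not at h1 h2 h3 h4 h5 h6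
  refine hE σ hσ ⟨?_, ?_⟩
  · refine (card_taken_threePhase_le hk0 d off (x ∘ σ) hm₁ hm₂ h0
      (c := sampleCenters off x m₁ σ) rfl).trans (Nat.add_le_add_right (le_of_lt ?_) _)
    convert h6 using 5
    simp
  · rw [hopt]
    exact IsRepresentative.cost_le hk hk0 hD hd hoff hm₁ hm₂ h0 x ⟨h1, h2, h3, h4, h5⟩

/-- The crude bound `log (40k) ≤ 40k` suffices: the close points then contribute order `k³`, below
the `k⁴` of the far points. -/
theorem far_add_close_le {k : ℕ} (hk : 1 ≤ k) :
    10 ^ 7 * k ^ 4 + k * (⌊3 * k * Real.log (40 * k)⌋₊ + 1) ≤ 10 ^ 8 * k ^ 5 := by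
  have hk1 : (1 : ℝ) ≤ k := by exact_mod_cast hk
  have hfloor : ⌊3 * k * Real.log (40 * k)⌋₊ ≤ 120 * k ^ 2 := by
    refine Nat.floor_le_of_le ?_
    have hlog : Real.log (40 * k) ≤ 40 * k := Real.log_le_self (by linarith)
    push_cast
    calc 3 * k * Real.log (40 * k) ≤ 3 * k * (40 * k) := by gcongr
      _ = _ := by ring
  calc 10 ^ 7 * k ^ 4 + k * (⌊3 * k * Real.log (40 * k)⌋₊ + 1)
      ≤ 10 ^ 7 * k ^ 4 + k * (120 * k ^ 2 + 1) := by gcongr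
    _ = 10 ^ 7 * k ^ 4 + 120 * k ^ 3 + k ^ 1 := by ring
    _ ≤ 10 ^ 7 * k ^ 5 + 120 * k ^ 5 + k ^ 5 := by gcongr <;> omega
    _ ≤ 10 ^ 8 * k ^ 5 := by omega

theorem nine_tenths_le_toOuterMeasure {α : Type*} [Fintype α] [Nonempty α] [DecidableEq α]
    (S : Set α) [DecidablePred (· ∈ S)]
    (h : 10 * (univ.filter fun a => a ∉ S).card ≤ Fintype.card α) :
    (9 / 10 : ℝ≥0∞) ≤ (PMF.uniformOfFintype α).toOuterMeasure S := by
  rw [PMF.toOuterMeasure_uniformOfFintype_apply,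
    ENNReal.le_div_iff_mul_le (Or.inl (by simp)) (Or.inl (by simp))]
  have hcard : 9 * Fintype.card α ≤ 10 * Fintype.card S := by
    have hadd := card_filter_add_card_filter_not (s := (univ : Finset α)) fun a => a ∈ S
    rw [card_univ] at hadd
    have : Fintype.card S = (univ.filter fun a => a ∈ S).card := Fintype.card_subtype _
    omega
  have hcard' : (9 * Fintype.card α : ℝ≥0∞) ≤ 10 * Fintype.card S := by exact_mod_cast hcard
  rw [← ENNReal.mul_div_right_comm]
  exact ENNReal.div_le_of_le_mul' hcard'

end NoSubstitution

theorem mainTheorem1 :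
    ∃ C : ℕ, ∀ k : ℕ, 2 ≤ k → ∀ D a : ℝ≥0, 1 ≤ D → 1 ≤ a → ∃ K : ℝ≥0,
      ∀ (X : Type u) (d : X → X → ℝ≥0), NoSubstitution.IsDCost D d →
      ∀ off : List X → Fin k → X, NoSubstitution.IsOfflineApprox d k a off →
      ∀ (n : ℕ) (x : Fin n → X),
        (9 / 10 : ℝ≥0∞) ≤ (PMF.uniformOfFintype (Equiv.Perm (Fin n))).toOuterMeasure
          {σ | ((NoSubstitution.threePhase d k off).taken (x ∘ σ)).card ≤ C * k ^ 5 ∧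
            NoSubstitution.cost d x
                ((x ∘ σ) '' ((NoSubstitution.threePhase d k off).taken (x ∘ σ) : Set (Fin n)))
              ≤ K * NoSubstitution.optCost d k x} := by
  classical
  refine ⟨10 ^ 8, fun k hk D a hD _ => ⟨NoSubstitution.approxFactor k D a,
    fun X d hd off hoff n x => NoSubstitution.nine_tenths_le_toOuterMeasure _ ?_⟩⟩
  -- With fewer than `100 k` points, everything is taken at cost zero, for every order; this
  -- includes `n = 0`.
  by_cases h0 : n / (10 ^ 2 * k) = 0
  · have hlt : n < 10 ^ 2 * k := by
      rcases (Nat.div_eq_zero_iff).1 h0 with h | h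
      · omega
      · exact h
    have hk5 : k ≤ k ^ 5 := Nat.le_self_pow (by norm_num) k
    rw [Finset.filter_eq_empty_iff.2]
    · simp
    intro σ _
    rw [not_not]
    refine ⟨?_, ?_⟩
    · rw [NoSubstitution.taken_threePhase_of_eq_zero d off _ h0, Finset.card_univ,
        Fintype.card_fin]
      omega
    · rw [NoSubstitution.taken_threePhase_of_eq_zero d off _ h0]
      have hcost : NoSubstitution.cost d x
          ((x ∘ σ) '' ((Finset.univ : Finset (Fin n)) : Set (Fin n))) = 0 := by
        refine Finset.sum_eq_zero fun v _ => le_antisymm ?_ zero_le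
        refine (iInf₂_le (x v) ⟨σ.symm v, by simp, by simp⟩).trans ?_
        rw [hd.self]; rfl
      rw [hcost]
      exact zero_le
  · refine NoSubstitution.ten_mul_card_le_of_fails hk hD hd hoff h0 x _ fun σ hσ h => ?_
    exact (Finset.mem_filter.1 hσ).2
      ⟨h.1.trans (NoSubstitution.far_add_close_le (by omega)), h.2⟩
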